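/- \textbf{Model.} A countable set $\mathbb C$ of clients accesses a set $\mathcal B$ of atomic (linearizable) multi-writer/multi-reader read/write base registers with an arbitrary value domain. A map $\delta:\mathcal B\to\mathcal S$ places each base register on a server of a finite set $\mathcal S$. Clients and servers may crash; when a server $s$ crashes, all base registers in $\delta^{-1}(\{s\})$ stop responding. An algorithm $A$ makes every client a deterministic state machine, which triggers low-level reads and writes on base registers (possibly without waiting for earlier ones to respond), receives their responses asynchronously, and returns from high-level operations. A $k$-register is a register with at least two possible values and some initial value; it can be written by a fixed set of exactly $k$ clients and read by all clients, at least one of which is not a writer. A run is fair if every low-level operation triggered by a correct client on a register of a correct server gets a response, and every correct client gets infinitely many opportunities to execute its ready trigger and return actions. Two high-level operations are concurrent if neither returns before the other is invoked. $A$ is an $f$-tolerant emulation of an obstruction-free, WS-Safe $k$-register if both of the following hold. \begin{itemize} \item (WS-Safety) For every run in which at most $f$ servers crash and no two high-level writes are concurrent, and for every complete high-level read $rd$ of the run that is not concurrent with any high-level write, the sequence of invocations and returns of $rd$ and of all high-level writes has a linearization with respect to the sequential specification of a register. \item (Obstruction freedom) In every fair run in which at most $f$ servers crash, every high-level operation invoked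 by a correct client that is not concurrent with any other high-level operation by a correct client returns. \end{itemize} \textbf{Theorem.} Let $k>0$ and $f>0$ be integers, let $|\mathcal S|\ge 2f+1$, and let $A$ be an $f$-tolerant emulation of an obstruction-free, WS-Safe $k$-register from base registers placed on $\mathcal S$. Then $A$ uses at least $$kf+\left\lceil \frac{kf}{|\mathcal S|-(f+1)}\right\rceil (f+1)$$ base registers: at least that many base registers have a low-level operation triggered on them in some run of $A$ and, in particular, $|\delta^{-1}(\mathcal S)|\ge kf+\left\lceil \frac{kf}{|\mathcal S|-(f+1)}\right\rceil (f+1)$. -/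

import Mathlib

universe uC uB uS uV uD uT

namespace RegisterEmulation

/-! ### Read/write registers, schedules and linearizations -/

/-- The operations of a read/write register with value domain `V`. -/
inductive RegOp (V : Type uV) : Type uV
  | read : RegOp V
  | write (v : V) : RegOp V

/-- The responses of a read/write register: an acknowledgement of a write, or the value returned
by a read. -/
inductive RegResp (V : Type uV) : Type uV
  | ack : RegResp V
  | val (v : V) : RegResp V

/-- An event of a register schedule: invocation or response of the operation named `i`. -/
inductive SchedEvent (ι : Type uC) (V : Type uV) : Type (max uC uV)
  | inv (i : ι) (o : RegOp V) : SchedEvent ι V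
  | res (i : ι) (a : RegResp V) : SchedEvent ι V

/-- The operation to which an event belongs. -/
def SchedEvent.opId {ι : Type uC} {V : Type uV} : SchedEvent ι V → ι
  | .inv i _ => i
  | .res i _ => i

/-- An operation of a sequential schedule, together with its response. -/
structure SeqOp (ι : Type uC) (V : Type uV) : Type (max uC uV) where
  id : ι
  op : RegOp V
  resp : RegResp V

/-- The sequential specification of a register that currently holds the value `v`: every read
returns the value of the last preceding write (or `v` if there is none), every write returns
`ack`. -/
def SeqSpec {ι : Type uC} {V : Type uV} : V → List (SeqOp ι V) → Prop
  | _, [] => True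
  | v, ⟨_, .read, a⟩ :: L => a = .val v ∧ SeqSpec v L
  | _, ⟨_, .write w, a⟩ :: L => a = .ack ∧ SeqSpec w L

section Schedules

variable {ι : Type uC} {V : Type uV}

/-- `i` precedes `j` in `σ`: the operation `j` is invoked after the operation `i` responds. -/
def Precedes (σ : List (SchedEvent ι V)) (i j : ι) : Prop :=
  ∃ a o, [SchedEvent.res i a, SchedEvent.inv j o].Sublist σ

/-- Two operations are concurrent if neither one precedes the other. -/
def Concurrent (σ : List (SchedEvent ι V)) (i j : ι) : Prop :=
  ¬ Precedes σ i j ∧ ¬ Precedes σ j i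

/-- The write operations invoked in `σ`. -/
def writes (σ : List (SchedEvent ι V)) : Set ι :=
  {i | ∃ v, SchedEvent.inv i (.write v) ∈ σ}

/-- The complete read operations of `σ`. -/
def completeReads (σ : List (SchedEvent ι V)) : Set ι :=
  {i | SchedEvent.inv i .read ∈ σ ∧ ∃ a, SchedEvent.res i a ∈ σ}

open Classical in
/-- The subsequence `σ | X` of all events of the operations in `X`. -/
noncomputable def restrict (σ : List (SchedEvent ι V)) (X : Set ι) : List (SchedEvent ι V) :=
  σ.filter (fun e => e.opId ∈ X)

/-- `L` is a linearization of `σ` for a register with initial value `v₀`: a sequential schedule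
which consists of all complete operations of `σ` with their responses and of some pending
operations of `σ` with arbitrary responses, respects the precedence relation of `σ` and satisfies
the sequential specification. -/
structure IsLinearization (v₀ : V) (σ : List (SchedEvent ι V)) (L : List (SeqOp ι V)) : Prop where
  nodup : (L.map SeqOp.id).Nodup
  invoked : ∀ e ∈ L, SchedEvent.inv e.id e.op ∈ σ
  resp_eq : ∀ e ∈ L, ∀ a, SchedEvent.res e.id a ∈ σ → e.resp = a
  complete : ∀ i a, SchedEvent.res i a ∈ σ → i ∈ L.map SeqOp.id
  order : ∀ i ∈ L.map SeqOp.id, ∀ j ∈ L.map SeqOp.id,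
    Precedes σ i j → [i, j].Sublist (L.map SeqOp.id)
  spec : SeqSpec v₀ L

/-- No two writes of `σ` are concurrent. -/
def WriteSequential (σ : List (SchedEvent ι V)) : Prop :=
  ∀ i ∈ writes σ, ∀ j ∈ writes σ, i ≠ j → ¬ Concurrent σ i j

/-- Write-sequential safety: if `σ` is write-sequential, then for every complete read `rd` that is
not concurrent with any write there is a linearization of `σ | (writes(σ) ∪ {rd})`. -/
def WSSafeSchedule (v₀ : V) (σ : List (SchedEvent ι V)) : Prop :=
  WriteSequential σ → ∀ rd ∈ completeReads σ, (∀ w ∈ writes σ, ¬ Concurrent σ rd w) →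
    ∃ L, IsLinearization v₀ (restrict σ (writes σ ∪ {rd})) L

end Schedules

/-! ### Emulation algorithms and their runs -/

/-- The locally controlled actions of a client: triggering a low-level operation on a base
register, or returning from the current high-level operation. -/
inductive ClientAct (B : Type uB) (V : Type uV) (D : Type uD) : Type (max uB uV uD)
  | trigger (b : B) (o : RegOp D) : ClientAct B V D
  | ret (a : RegResp V) : ClientAct B V D

/-- An algorithm that emulates a register with value domain `V` for the clients `C`, from base
read/write registers `B` with value domain `D`. Every client is a deterministic state machine. -/
structure Emulation (C : Type uC) (B : Type uB) (V : Type uV) (D : Type uD) where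
  /-- local states of a client -/
  State : C → Type uT
  /-- initial state of a client -/
  init : ∀ c, State c
  /-- initial value of a base register -/
  initVal : B → D
  /-- state change at the invocation of a high-level operation -/
  onInvoke : ∀ c, State c → RegOp V → State c
  /-- the locally controlled action that is ready in a state, if there is one -/
  next : ∀ c, State c → Option (ClientAct B V D)
  /-- state change when the ready locally controlled action is executed -/
  afterNext : ∀ c, State c → State c
  /-- state change at the arrival of the response `a` of base register `b` to the low-level
  operation number `i` of the client -/
  onRespond : ∀ c, State c → (i : ℕ) → (b : B) → (a : RegResp D) → State c

/-- The actions occurring in runs. High-level operations are named by `(c, m)`: the `m`-th one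
invoked by client `c`. Low-level operations are named by `(c, i)`: the `i`-th one triggered by
client `c`. Both numberings start from zero. -/
inductive Action (C : Type uC) (B : Type uB) (S : Type uS) (V : Type uV) (D : Type uD) :
    Type (max uC uB uS uV uD)
  | invoke (c : C) (m : ℕ) (o : RegOp V) : Action C B S V D
  | ret (c : C) (m : ℕ) (a : RegResp V) : Action C B S V D
  | trigger (c : C) (i : ℕ) (b : B) (o : RegOp D) : Action C B S V D
  | respond (c : C) (i : ℕ) (b : B) (a : RegResp D) : Action C B S V D
  | crashClient (c : C) : Action C B S V D
  | crashServer (s : S) : Action C B S V D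

section Runs

variable {C : Type uC} {B : Type uB} {S : Type uS} {V : Type uV} {D : Type uD}

/-- The high-level event made by an action, if any. -/
def highEvent : Action C B S V D → Option (SchedEvent (C × ℕ) V)
  | .invoke c m o => some (.inv (c, m) o)
  | .ret c m a => some (.res (c, m) a)
  | _ => none

/-- The schedule of the emulated register. -/
def highSchedule (l : List (Action C B S V D)) : List (SchedEvent (C × ℕ) V) :=
  l.filterMap highEvent

open Classical in
/-- The event made by an action at the base register `b`, if any. -/
noncomputable def baseEvent (b : B) : Action C B S V D → Option (SchedEvent (C × ℕ) D)
  | .trigger c i b' o => if b' = b then some (.inv (c, i) o) else none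
  | .respond c i b' a => if b' = b then some (.res (c, i) a) else none
  | _ => none

/-- The schedule of the base register `b`. -/
noncomputable def baseSchedule (b : B) (l : List (Action C B S V D)) :
    List (SchedEvent (C × ℕ) D) :=
  l.filterMap (baseEvent b)

/-- The servers that crash during a finite sequence of actions. -/
def crashedIn (l : List (Action C B S V D)) : Set S :=
  {s | Action.crashServer s ∈ l}

/-- The actions that occur before tick `n`. -/
def prefixOf (ρ : ℕ → Option (Action C B S V D)) (n : ℕ) : List (Action C B S V D) :=
  (List.range n).filterMap ρ

/-- The client `c` never crashes in `ρ`. -/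
def CorrectClient (ρ : ℕ → Option (Action C B S V D)) (c : C) : Prop :=
  ∀ t, ρ t ≠ some (.crashClient c)

/-- The server `s` never crashes in `ρ`. -/
def CorrectServer (ρ : ℕ → Option (Action C B S V D)) (s : S) : Prop :=
  ∀ t, ρ t ≠ some (.crashServer s)

/-- The high-level operation `q` is invoked after the high-level operation `p` returns. -/
def HighPrecedes (ρ : ℕ → Option (Action C B S V D)) (p q : C × ℕ) : Prop :=
  ∃ t t' a o, t < t' ∧ ρ t = some (.ret p.1 p.2 a) ∧ ρ t' = some (.invoke q.1 q.2 o)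

/-- The action is a locally controlled action (trigger or return) of client `c`. -/
def IsLocalActionOf (c : C) : Action C B S V D → Prop
  | .trigger c' _ _ _ => c' = c
  | .ret c' _ _ => c' = c
  | _ => False

namespace Emulation

/-- A configuration: the local states of the clients, how many high-level operations each of them
has invoked and how many low-level operations it has triggered, the clients with a high-level
operation in progress, the pending low-level operations (client, number, base register), and the
crashed clients and servers. -/
structure Config (A : Emulation.{uC, uB, uV, uD, uT} C B V D) (S : Type uS) where
  state : ∀ c, A.State c
  numInvoked : C → ℕ
  numTriggered : C → ℕ
  busy : Set C
  pending : Set (C × ℕ × B)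
  crashedClients : Set C
  crashedServers : Set S

variable (A : Emulation.{uC, uB, uV, uD, uT} C B V D)

/-- The initial configuration. -/
def initConfig (S : Type uS) : A.Config S where
  state := A.init
  numInvoked := fun _ => 0
  numTriggered := fun _ => 0
  busy := ∅
  pending := ∅
  crashedClients := ∅
  crashedServers := ∅

/-- The action `a` can occur in the configuration `γ`. Here `δ` maps each base register to the
server that stores it and `W` is the set of writers. Invocations, responses and crashes are chosen
by the environment; a client executes only its ready locally controlled action; crashed clients
take no steps, and registers on crashed servers do not respond. -/
def Enabled (δ : B → S) (W : Finset C) (γ : A.Config S) : Action C B S V D → Prop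
  | .invoke c m o => c ∉ γ.crashedClients ∧ c ∉ γ.busy ∧ m = γ.numInvoked c ∧
      ((∃ v, o = .write v) → c ∈ W)
  | .ret c m a => c ∉ γ.crashedClients ∧ c ∈ γ.busy ∧ m + 1 = γ.numInvoked c ∧
      A.next c (γ.state c) = some (.ret a)
  | .trigger c i b o => c ∉ γ.crashedClients ∧ i = γ.numTriggered c ∧
      A.next c (γ.state c) = some (.trigger b o)
  | .respond c i b _ => c ∉ γ.crashedClients ∧ δ b ∉ γ.crashedServers ∧ (c, i, b) ∈ γ.pending
  | .crashClient _ => True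
  | .crashServer _ => True

open Classical in
/-- The configuration reached from `γ` by an action. -/
noncomputable def apply (γ : A.Config S) : Action C B S V D → A.Config S
  | .invoke c _ o =>
      { γ with
        state := Function.update γ.state c (A.onInvoke c (γ.state c) o)
        numInvoked := Function.update γ.numInvoked c (γ.numInvoked c + 1)
        busy := γ.busy ∪ {c} }
  | .ret c _ _ =>
      { γ with
        state := Function.update γ.state c (A.afterNext c (γ.state c))
        busy := γ.busy \ {c} }
  | .trigger c i b _ =>
      { γ with
        state := Function.update γ.state c (A.afterNext c (γ.state c))
        numTriggered := Function.update γ.numTriggered c (γ.numTriggered c + 1)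
        pending := γ.pending ∪ {(c, i, b)} }
  | .respond c i b a =>
      { γ with
        state := Function.update γ.state c (A.onRespond c (γ.state c) i b a)
        pending := γ.pending \ {(c, i, b)} }
  | .crashClient c => { γ with crashedClients := γ.crashedClients ∪ {c} }
  | .crashServer s => { γ with crashedServers := γ.crashedServers ∪ {s} }

/-- The actions can occur one after the other, starting in the configuration `γ`. -/
def Steps (δ : B → S) (W : Finset C) : A.Config S → List (Action C B S V D) → Prop
  | _, [] => True
  | γ, a :: l => A.Enabled δ W γ a ∧ Steps δ W (A.apply γ a) l

/-- The configuration after a finite sequence of actions. -/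
noncomputable def configAfter (S : Type uS) (l : List (Action C B S V D)) : A.Config S :=
  l.foldl A.apply (A.initConfig S)

/-- Finite runs: the actions occur according to the algorithm, and every base register is
atomic, that is, its schedule has a linearization. -/
def IsRun (δ : B → S) (W : Finset C) (l : List (Action C B S V D)) : Prop :=
  A.Steps δ W (A.initConfig S) l ∧
    ∀ b, ∃ L, IsLinearization (A.initVal b) (baseSchedule b l) L

/-- Finite or infinite runs, presented as maps from ticks to actions, where `none` says that
nothing happens at that tick; the finite runs are those that are eventually `none`. -/
def IsTimedRun (δ : B → S) (W : Finset C) (ρ : ℕ → Option (Action C B S V D)) : Prop :=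
  ∀ n, A.IsRun δ W (prefixOf ρ n)

/-- Fair runs: every low-level operation triggered by a correct client on a register of a correct
server gets a response, and every correct client gets infinitely many opportunities to execute its
locally controlled actions, that is, at infinitely many ticks it executes one or has none that it
can execute. -/
def IsFair (δ : B → S) (W : Finset C) (ρ : ℕ → Option (Action C B S V D)) : Prop :=
  (∀ t c i b o, ρ t = some (.trigger c i b o) → CorrectClient ρ c → CorrectServer ρ (δ b) →
    ∃ t' a, ρ t' = some (.respond c i b a)) ∧
  (∀ c, CorrectClient ρ c → ∀ t, ∃ t', t ≤ t' ∧
    ((∃ a, ρ t' = some a ∧ IsLocalActionOf c a) ∨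
      ∀ a, IsLocalActionOf c a → ¬ A.Enabled δ W (A.configAfter S (prefixOf ρ t')) a))

/-- The emulation of a register with initial value `v₀` is write-sequentially safe in all runs in
which at most `f` servers crash. -/
def WSSafe (δ : B → S) (W : Finset C) (v₀ : V) (f : ℕ) : Prop :=
  ∀ l : List (Action C B S V D), A.IsRun δ W l → (crashedIn l).encard ≤ f →
    WSSafeSchedule v₀ (highSchedule l)

/-- Obstruction freedom in all fair runs in which at most `f` servers crash: every high-level
operation invoked by a correct client that is not concurrent with any other high-level operation
by a correct client returns. -/
def ObstructionFree (δ : B → S) (W : Finset C) (f : ℕ) : Prop :=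
  ∀ ρ : ℕ → Option (Action C B S V D), A.IsTimedRun δ W ρ → A.IsFair δ W ρ →
    {s | ¬ CorrectServer ρ s}.encard ≤ f →
    ∀ t c m o, ρ t = some (.invoke c m o) → CorrectClient ρ c →
      (∀ t' c' m' o', ρ t' = some (.invoke c' m' o') → CorrectClient ρ c' →
        (c', m') ≠ (c, m) → HighPrecedes ρ (c, m) (c', m') ∨ HighPrecedes ρ (c', m') (c, m)) →
      ∃ t' a, ρ t' = some (.ret c m a)

/-- `A` is an `f`-tolerant emulation of an obstruction-free, WS-Safe register with writers `W` and
initial value `v₀`. -/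
def IsTolerantEmulation (δ : B → S) (W : Finset C) (v₀ : V) (f : ℕ) : Prop :=
  A.WSSafe δ W v₀ f ∧ A.ObstructionFree δ W f

/-- The base registers on which a low-level operation is triggered in some run. -/
def usedRegisters (δ : B → S) (W : Finset C) : Set B :=
  {b | ∃ l : List (Action C B S V D), A.IsRun δ W l ∧ ∃ c i o, Action.trigger c i b o ∈ l}

end Emulation

end Runs

/-- `k f + ⌈k f / (n - (f + 1))⌉ (f + 1)`. -/
def registerBound (k f n : ℕ) : ℕ :=
  k * f + ⌈((k : ℚ) * f) / ((n : ℚ) - (f + 1))⌉₊ * (f + 1)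

end RegisterEmulation

/-! Fix a set `F` of `f + 1` servers. An adversary lets the writers perform one high-level write
each, in sequence and without any crash, so that every write leaves low-level writes pending on `f`
further base registers, all outside `F`. After all `k` writes, `k f` distinct registers outside `F`
are covered by pending writes (`exists_covered`).

The adversary relies on two facts. First, a client running alone must finish its operation even if
any `f` servers keep silent, because they might have crashed together with all other clients
(`ObstructionFree.exists_solo`). The crashes are afterwards erased from the run, so that the silent
servers are merely slow. Second, a completed write of a new value must change an uncovered register
outside any given set `R` of at most `f` servers (`IsCovering.exists_mem_ne`). Otherwise the
covering writes could take effect and erase its traces on the covered registers, and a reader that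
hears nothing from `R` could not tell whether the write had happened.

In `IsCovering.exists_write` the adversary withholds the responses of servers on which the writer
has triggered a low-level write to an uncovered register. At most `f` servers are blocked at a time;
when one more appears, a blocked server of `F` is released into `R`. If the write returned before
`f` blocked servers lay outside `F`, its effects on uncovered registers would be confined to a set
`R` of at most `f` servers, against the second fact.

The bound follows by choosing `F` twice (`registerBound_le_card`). Let `q` be the ceiling in the
bound. If at most `f` servers held `q` used registers, an `F` containing them would leave too little
room for `k f` registers outside it. Hence some `F` consists of servers that hold `q` used registers
each, and `k f` more lie outside it.

Base registers are simulated by a memory in which operations take effect at their responses. Pending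
writes then have no effect yet, and atomicity is automatic (`MemSteps.isRun`). -/

namespace RegisterEmulation

/-! ### Sequential semantics of registers -/

section Sequential

variable {ι : Type uC} {V : Type uV}

/-- The response of a register holding `d` to an operation. -/
def RegOp.expectedResp : RegOp V → V → RegResp V
  | .read, d => .val d
  | .write _, _ => .ack

/-- The value of a register holding `d` after an operation. -/
def RegOp.storedValue : RegOp V → V → V
  | .read, d => d
  | .write v, _ => v

/-- The value of a register initially holding `v` after a sequential schedule. -/
def finalValue (v : V) (L : List (SeqOp ι V)) : V :=
  L.foldl (fun d e => e.op.storedValue d) v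

theorem seqSpec_cons (v : V) (e : SeqOp ι V) (L : List (SeqOp ι V)) :
    SeqSpec v (e :: L) ↔ e.resp = e.op.expectedResp v ∧ SeqSpec (e.op.storedValue v) L := by
  rcases e with ⟨i, _ | w, a⟩ <;> rfl

theorem seqSpec_append_singleton (v : V) (L : List (SeqOp ι V)) (e : SeqOp ι V) :
    SeqSpec v (L ++ [e]) ↔ SeqSpec v L ∧ e.resp = e.op.expectedResp (finalValue v L) := by
  induction L generalizing v with
  | nil => simp [seqSpec_cons, SeqSpec, finalValue]
  | cons d L ih =>
    rw [List.cons_append, seqSpec_cons, seqSpec_cons, ih, and_assoc]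
    rfl

theorem finalValue_append_singleton (v : V) (L : List (SeqOp ι V)) (e : SeqOp ι V) :
    finalValue v (L ++ [e]) = e.op.storedValue (finalValue v L) := by
  simp [finalValue]

theorem sublist_of_sublist_append_singleton {α : Type*} {a b e : α} {σ : List α}
    (h : [a, b].Sublist (σ ++ [e])) (hb : b ≠ e) : [a, b].Sublist σ := by
  have h' := h.reverse
  simp only [List.reverse_append, List.reverse_cons, List.reverse_nil, List.nil_append,
    List.cons_append] at h'
  cases h' with
  | cons _ h' => simpa using h'.reverse
  | cons_cons _ h' => exact absurd rfl hb

/-- A pending operation may be left out of a linearization, and a new last invocation creates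
precedences only towards the operation that is left out. -/
theorem IsLinearization.append_inv {v : V} {σ : List (SchedEvent ι V)} {L : List (SeqOp ι V)}
    (h : IsLinearization v σ L) {j : ι} {o : RegOp V} (hj : ∀ o', SchedEvent.inv j o' ∉ σ) :
    IsLinearization v (σ ++ [.inv j o]) L where
  nodup := h.nodup
  invoked e he := by simp [h.invoked e he]
  resp_eq e he a ha := h.resp_eq e he a (by simpa using ha)
  complete i a ha := h.complete i a (by simpa using ha)
  order i hi i' hi' hp := by
    obtain ⟨a, o', hp⟩ := hp
    refine h.order i hi i' hi' ⟨a, o', sublist_of_sublist_append_singleton hp ?_⟩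
    rintro heq
    obtain ⟨e, he, rfl⟩ := List.mem_map.1 hi'
    simp only [SchedEvent.inv.injEq] at heq
    exact hj _ (heq.1 ▸ h.invoked e he)
  spec := h.spec

/-- The responding operation can be put last: nothing is invoked after this final event, and
whatever precedes the operation has responded and so is already in `L`. -/
theorem IsLinearization.append_res {v : V} {σ : List (SchedEvent ι V)} {L : List (SeqOp ι V)}
    (h : IsLinearization v σ L) {j : ι} {o : RegOp V} (hj : SchedEvent.inv j o ∈ σ)
    (hL : j ∉ L.map SeqOp.id) :
    IsLinearization v (σ ++ [.res j (o.expectedResp (finalValue v L))])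
      (L ++ [⟨j, o, o.expectedResp (finalValue v L)⟩]) where
  nodup := by
    rw [List.map_append, List.nodup_append]
    refine ⟨h.nodup, by simp, ?_⟩
    rintro a ha b hb rfl
    simp only [List.map_cons, List.map_nil, List.mem_singleton] at hb
    exact hL (hb ▸ ha)
  invoked e he := by
    rw [List.mem_append, List.mem_singleton] at he
    rcases he with he | rfl
    · simp [h.invoked e he]
    · simp [hj]
  resp_eq e he a ha := by
    rw [List.mem_append, List.mem_singleton] at he ha
    rcases he with he | rfl
    · rcases ha with ha | ha
      · exact h.resp_eq e he a ha
      · simp only [SchedEvent.res.injEq] at ha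
        exact absurd (List.mem_map.2 ⟨e, he, ha.1⟩) hL
    · rcases ha with ha | ha
      · exact absurd (h.complete _ _ ha) hL
      · simp only [SchedEvent.res.injEq] at ha
        exact ha.2.symm
  complete i a ha := by
    rw [List.mem_append, List.mem_singleton] at ha
    rcases ha with ha | ha
    · simpa using Or.inl (by simpa using h.complete i a ha)
    · simp only [SchedEvent.res.injEq] at ha
      simp [ha.1]
  order i hi i' hi' hp := by
    obtain ⟨a, o', hp⟩ := hp
    have hp := sublist_of_sublist_append_singleton hp (by simp)
    have hiL : i ∈ L.map SeqOp.id := h.complete i a (hp.subset (by simp))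
    rw [List.map_append, List.mem_append] at hi'
    rw [List.map_append]
    rcases hi' with hi' | hi'
    · exact (h.order i hiL i' hi' ⟨a, o', hp⟩).trans (List.sublist_append_left _ _)
    · simp only [List.map_cons, List.map_nil, List.mem_singleton] at hi'
      subst hi'
      exact (List.singleton_sublist.2 hiL).append (List.Sublist.refl [i'])
  spec := (seqSpec_append_singleton _ _ _).2 ⟨h.spec, rfl⟩

end Sequential

/-! ### Executions in which low-level operations take effect at their responses -/

namespace Emulation

variable {C : Type uC} {B : Type uB} {S : Type uS} {V : Type uV} {D : Type uD}

/-- A configuration together with the contents of the base registers and the low-level operation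
behind each name. -/
structure MemConfig (A : Emulation.{uC, uB, uV, uD, uT} C B V D) (S : Type uS) where
  cfg : A.Config S
  mem : B → D
  opOf : C × ℕ → RegOp D

variable (A : Emulation.{uC, uB, uV, uD, uT} C B V D)

/-- The initial configuration with the initial contents of the base registers. -/
def initMem (S : Type uS) : A.MemConfig S where
  cfg := A.initConfig S
  mem := A.initVal
  opOf := fun _ => .read

variable {A}

/-- The action can occur, and it is not a response with a wrong value. -/
def MemEnabled (δ : B → S) (W : Finset C) (X : A.MemConfig S) (a : Action C B S V D) : Prop :=
  A.Enabled δ W X.cfg a ∧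
    ∀ c i b r, a = .respond c i b r → r = (X.opOf (c, i)).expectedResp (X.mem b)

open Classical in
/-- The configuration reached by an action; operations take effect at their responses. -/
noncomputable def memApply (X : A.MemConfig S) (a : Action C B S V D) : A.MemConfig S where
  cfg := A.apply X.cfg a
  mem := match a with
    | .respond c i b _ => Function.update X.mem b ((X.opOf (c, i)).storedValue (X.mem b))
    | _ => X.mem
  opOf := match a with
    | .trigger c i _ o => Function.update X.opOf (c, i) o
    | _ => X.opOf

/-- The actions can occur one after the other, starting in the configuration `X`. -/
def MemSteps (δ : B → S) (W : Finset C) : A.MemConfig S → List (Action C B S V D) → Prop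
  | _, [] => True
  | X, a :: l => MemEnabled δ W X a ∧ MemSteps δ W (memApply X a) l

/-- The configuration after a finite sequence of actions. -/
noncomputable def memAfter (X : A.MemConfig S) (l : List (Action C B S V D)) : A.MemConfig S :=
  l.foldl memApply X

variable {δ : B → S} {W : Finset C}

theorem memAfter_append (X : A.MemConfig S) (l l' : List (Action C B S V D)) :
    memAfter X (l ++ l') = memAfter (memAfter X l) l' := by
  simp [memAfter]

theorem memAfter_cons (X : A.MemConfig S) (a : Action C B S V D) (l : List (Action C B S V D)) :
    memAfter X (a :: l) = memAfter (memApply X a) l := rfl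

@[simp] theorem memAfter_nil (X : A.MemConfig S) : memAfter X [] = X := rfl

theorem memSteps_append {X : A.MemConfig S} {l l' : List (Action C B S V D)} :
    MemSteps δ W X (l ++ l') ↔ MemSteps δ W X l ∧ MemSteps δ W (memAfter X l) l' := by
  induction l generalizing X with
  | nil => simp [MemSteps]
  | cons a l ih => simp only [List.cons_append, MemSteps, ih, memAfter_cons, and_assoc]

theorem memSteps_append_singleton {X : A.MemConfig S} {l : List (Action C B S V D)}
    {a : Action C B S V D} :
    MemSteps δ W X (l ++ [a]) ↔ MemSteps δ W X l ∧ MemEnabled δ W (memAfter X l) a := by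
  simp [memSteps_append, MemSteps]

theorem cfg_memAfter (X : A.MemConfig S) (l : List (Action C B S V D)) :
    (memAfter X l).cfg = l.foldl A.apply X.cfg := by
  induction l generalizing X with
  | nil => rfl
  | cons a l ih => exact ih _

theorem MemSteps.steps {X : A.MemConfig S} {l : List (Action C B S V D)}
    (h : MemSteps δ W X l) : A.Steps δ W X.cfg l := by
  induction l generalizing X with
  | nil => trivial
  | cons a l ih => exact ⟨h.1.1, ih h.2⟩

/-- What relates the schedules of the base registers and the configuration. -/
structure MemInvariant (l : List (Action C B S V D)) (X : A.MemConfig S) : Prop where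
  lt_numTriggered : ∀ b c i o, SchedEvent.inv (c, i) o ∈ baseSchedule b l →
    i < X.cfg.numTriggered c
  inv_mem : ∀ b c i, (c, i, b) ∈ X.cfg.pending →
    SchedEvent.inv (c, i) (X.opOf (c, i)) ∈ baseSchedule b l
  res_notMem : ∀ b c i, (c, i, b) ∈ X.cfg.pending → ∀ a, SchedEvent.res (c, i) a ∉ baseSchedule b l
  pending_unique : ∀ b b' c i, (c, i, b) ∈ X.cfg.pending → (c, i, b') ∈ X.cfg.pending → b = b'
  linearization : ∀ b, ∃ L, IsLinearization (A.initVal b) (baseSchedule b l) L ∧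
    finalValue (A.initVal b) L = X.mem b ∧
    ∀ i ∈ L.map SeqOp.id, ∃ a, SchedEvent.res i a ∈ baseSchedule b l

theorem MemInvariant.nil : MemInvariant ([] : List (Action C B S V D)) (A.initMem S) where
  lt_numTriggered _ _ _ _ h := absurd h (by simp [baseSchedule])
  inv_mem _ _ _ h := absurd h (by simp [initMem, initConfig])
  res_notMem _ _ _ h := absurd h (by simp [initMem, initConfig])
  pending_unique _ _ _ _ h := absurd h (by simp [initMem, initConfig])
  linearization b := ⟨[], ⟨by simp, by simp, by simp, by simp [baseSchedule], by simp, trivial⟩,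
    rfl, by simp⟩

theorem baseSchedule_append_singleton (b : B) (l : List (Action C B S V D))
    (a : Action C B S V D) :
    baseSchedule b (l ++ [a]) = baseSchedule b l ++ (baseEvent b a).toList := by
  rw [baseSchedule, List.filterMap_append, baseSchedule]
  cases h : baseEvent b a <;> simp [h]

/-- The linearization lists the operations of a register in the order of their responses. A trigger
leaves it alone and a response extends it; the responding operation is not yet listed because listed
operations have already responded. -/
theorem MemInvariant.append {l : List (Action C B S V D)} {X : A.MemConfig S}
    (h : MemInvariant l X) {a : Action C B S V D} (ha : MemEnabled δ W X a) :
    MemInvariant (l ++ [a]) (memApply X a) := by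
  classical
  have other (hb : ∀ b, baseEvent b a = none)
      (hp : (A.apply X.cfg a).pending = X.cfg.pending)
      (hn : (A.apply X.cfg a).numTriggered = X.cfg.numTriggered)
      (hm : (memApply X a).mem = X.mem) (ho : (memApply X a).opOf = X.opOf) :
      MemInvariant (l ++ [a]) (memApply X a) := by
    have hs (b) : baseSchedule b (l ++ [a]) = baseSchedule b l := by
      simp [baseSchedule_append_singleton, hb]
    constructor <;> simp only [hs, hm, ho, show (memApply X a).cfg = A.apply X.cfg a from rfl,
      hp, hn]
    exacts [h.1, h.2, h.3, h.4, h.5]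
  rcases a with ⟨c, m, o⟩ | ⟨c, m, r⟩ | ⟨c, i, b, o⟩ | ⟨c, i, b, r⟩ | c | s
  · exact other (fun _ => rfl) rfl rfl rfl rfl
  · exact other (fun _ => rfl) rfl rfl rfl rfl
  · obtain ⟨-, rfl, -⟩ := ha.1
    have hlt {b c i} (hp : (c, i, b) ∈ X.cfg.pending) : i < X.cfg.numTriggered c :=
      h.lt_numTriggered _ _ _ _ (h.inv_mem _ _ _ hp)
    have hn (c' : C) : X.cfg.numTriggered c' ≤
        Function.update X.cfg.numTriggered c (X.cfg.numTriggered c + 1) c' := by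
      by_cases hc : c' = c
      · subst hc; simp
      · simp [hc]
    have hsub (b') : baseSchedule b' (l ++ [Action.trigger c (X.cfg.numTriggered c) b o]) =
        baseSchedule b' l ++
          (if b = b' then [.inv (c, X.cfg.numTriggered c) o] else []) := by
      rw [baseSchedule_append_singleton]
      simp only [baseEvent]
      split_ifs <;> rfl
    constructor
    · intro b' c' i' o' hi
      rw [hsub, List.mem_append] at hi
      rcases hi with hi | hi
      · exact (h.lt_numTriggered _ _ _ _ hi).trans_le (hn c')
      · split_ifs at hi
        · simp only [List.mem_singleton, SchedEvent.inv.injEq, Prod.mk.injEq] at hi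
          obtain ⟨⟨rfl, rfl⟩, rfl⟩ := hi
          simp [memApply, apply]
        · simp at hi
    · intro b' c' i' hp
      rw [hsub]
      rcases hp with hp | hp
      · have : (c', i') ≠ (c, X.cfg.numTriggered c) := by
          rintro heq
          simp only [Prod.mk.injEq] at heq
          obtain ⟨rfl, rfl⟩ := heq
          exact (hlt hp).ne rfl
        simp only [memApply, Function.update_of_ne this]
        exact List.mem_append_left _ (h.inv_mem _ _ _ hp)
      · simp only [Set.mem_singleton_iff, Prod.mk.injEq] at hp
        obtain ⟨rfl, rfl, rfl⟩ := hp
        simp [memApply]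
    · intro b' c' i' hp r hr
      have hr' : SchedEvent.res (c', i') r ∈ baseSchedule b' l := by
        rw [hsub, List.mem_append] at hr
        refine hr.resolve_right fun hr => ?_
        split_ifs at hr <;> simp at hr
      rcases hp with hp | hp
      · exact h.res_notMem _ _ _ hp r hr'
      · simp only [Set.mem_singleton_iff, Prod.mk.injEq] at hp
        obtain ⟨rfl, rfl, rfl⟩ := hp
        obtain ⟨L, hL, -, -⟩ := h.linearization b'
        obtain ⟨e, he, heq⟩ := List.mem_map.1 (hL.complete _ _ hr')
        exact (h.lt_numTriggered _ _ _ _ (heq ▸ hL.invoked e he)).ne rfl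
    · rintro b₁ b₂ c' i' (h₁ | h₁) (h₂ | h₂)
      · exact h.pending_unique _ _ _ _ h₁ h₂
      · simp only [Set.mem_singleton_iff, Prod.mk.injEq] at h₂
        obtain ⟨rfl, rfl, rfl⟩ := h₂
        exact absurd rfl (hlt h₁).ne
      · simp only [Set.mem_singleton_iff, Prod.mk.injEq] at h₁
        obtain ⟨rfl, rfl, rfl⟩ := h₁
        exact absurd rfl (hlt h₂).ne
      · simp only [Set.mem_singleton_iff, Prod.mk.injEq] at h₁ h₂
        rw [h₁.2.2, h₂.2.2]
    · intro b'
      obtain ⟨L, hL, hv, hr⟩ := h.linearization b'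
      rw [hsub]
      refine ⟨L, ?_, hv, fun i hi => ?_⟩
      · split_ifs
        · exact hL.append_inv fun o' ho' => (h.lt_numTriggered _ _ _ _ ho').ne rfl
        · simpa using hL
      · obtain ⟨a, ha⟩ := hr i hi
        exact ⟨a, List.mem_append_left _ ha⟩
  · obtain ⟨-, -, hp₀⟩ := ha.1
    obtain rfl := ha.2 c i b r rfl
    set r := (X.opOf (c, i)).expectedResp (X.mem b)
    have hsub (b') : baseSchedule b' (l ++ [Action.respond c i b r]) =
        baseSchedule b' l ++ (if b = b' then [.res (c, i) r] else []) := by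
      rw [baseSchedule_append_singleton]
      simp only [baseEvent]
      split_ifs <;> rfl
    constructor
    · intro b' c' i' o' hi
      rw [hsub, List.mem_append] at hi
      rcases hi with hi | hi
      · exact h.lt_numTriggered _ _ _ _ hi
      · split_ifs at hi <;> simp at hi
    · intro b' c' i' hp
      rw [hsub]
      exact List.mem_append_left _ (h.inv_mem _ _ _ hp.1)
    · intro b' c' i' hp r' hr
      rw [hsub, List.mem_append] at hr
      rcases hr with hr | hr
      · exact h.res_notMem _ _ _ hp.1 _ hr
      · split_ifs at hr with hb
        · simp only [List.mem_singleton, SchedEvent.res.injEq, Prod.mk.injEq] at hr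
          obtain ⟨⟨rfl, rfl⟩, rfl⟩ := hr
          subst hb
          exact hp.2 rfl
        · simp at hr
    · intro b₁ b₂ c' i' h₁ h₂
      exact h.pending_unique _ _ _ _ h₁.1 h₂.1
    · intro b'
      obtain ⟨L, hL, hv, hr⟩ := h.linearization b'
      rw [hsub]
      by_cases hb : b = b'
      · subst hb
        refine ⟨L ++ [⟨(c, i), X.opOf (c, i), r⟩], ?_, ?_, ?_⟩
        · have := hL.append_res (h.inv_mem _ _ _ hp₀) (fun hm => by
            obtain ⟨a, ha⟩ := hr _ hm
            exact h.res_notMem _ _ _ hp₀ _ ha)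
          simpa [hv, r] using this
        · simp [finalValue_append_singleton, hv, memApply]
        · intro j hj
          rw [List.map_append, List.mem_append] at hj
          rcases hj with hj | hj
          · obtain ⟨a, ha⟩ := hr _ hj
            exact ⟨a, List.mem_append_left _ ha⟩
          · simp only [List.map_cons, List.map_nil, List.mem_singleton] at hj
            exact ⟨r, by simp [hj]⟩
      · refine ⟨L, by simpa [hb] using hL, ?_, by simpa [hb] using hr⟩
        simp [memApply, Function.update_of_ne (Ne.symm hb), hv]
  · exact other (fun _ => rfl) rfl rfl rfl rfl
  · exact other (fun _ => rfl) rfl rfl rfl rfl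

theorem MemSteps.invariant {l : List (Action C B S V D)}
    (h : MemSteps δ W (A.initMem S) l) : MemInvariant l (memAfter (A.initMem S) l) := by
  induction l using List.reverseRecOn with
  | nil => exact MemInvariant.nil
  | append_singleton l a ih =>
    rw [memSteps_append_singleton] at h
    rw [memAfter_append]
    exact (ih h.1).append h.2

theorem MemSteps.isRun {l : List (Action C B S V D)}
    (h : MemSteps δ W (A.initMem S) l) : A.IsRun δ W l :=
  ⟨h.steps, fun b => let ⟨L, hL, _⟩ := h.invariant.linearization b; ⟨L, hL⟩⟩

theorem MemSteps.exists_trigger_of_pending {l : List (Action C B S V D)}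
    (h : MemSteps δ W (A.initMem S) l) {c : C} {i : ℕ} {b : B}
    (hp : (c, i, b) ∈ (memAfter (A.initMem S) l).cfg.pending) :
    Action.trigger c i b ((memAfter (A.initMem S) l).opOf (c, i)) ∈ l := by
  have := h.invariant.inv_mem _ _ _ hp
  obtain ⟨a, ha, he⟩ := List.mem_filterMap.1 this
  rcases a with _ | _ | ⟨c', i', b', o'⟩ | ⟨c', i', b', r⟩ | _ | _ <;>
    simp only [baseEvent, reduceCtorEq] at he
  all_goals split_ifs at he with hb
  all_goals simp only [Option.some.injEq, SchedEvent.inv.injEq, Prod.mk.injEq, reduceCtorEq] at he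
  obtain ⟨⟨rfl, rfl⟩, ho⟩ := he
  rwa [hb, ho] at ha

end Emulation

end RegisterEmulation

namespace RegisterEmulation

/-! ### Solo runs -/

section Prefix

variable {C : Type uC} {B : Type uB} {S : Type uS} {V : Type uV} {D : Type uD}

theorem prefixOf_succ (ρ : ℕ → Option (Action C B S V D)) (n : ℕ) :
    prefixOf ρ (n + 1) = prefixOf ρ n ++ (ρ n).toList := by
  rw [prefixOf, List.range_succ, List.filterMap_append, prefixOf]
  cases h : ρ n <;> simp [h]

/-- The action is an invocation, return, trigger or response of client `c`. -/
def IsActionOf (c : C) : Action C B S V D → Prop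
  | .invoke c' _ _ => c' = c
  | .ret c' _ _ => c' = c
  | .trigger c' _ _ _ => c' = c
  | .respond c' _ _ _ => c' = c
  | .crashClient _ => False
  | .crashServer _ => False

/-- The action is a trigger of client `c`, or a response to it from a server outside `Bl`. -/
def IsSoloAction (δ : B → S) (Bl : Finset S) (c : C) : Action C B S V D → Prop
  | .trigger c' _ _ _ => c' = c
  | .respond c' _ b _ => c' = c ∧ δ b ∉ Bl
  | _ => False

theorem IsSoloAction.isActionOf {δ : B → S} {Bl : Finset S} {c : C} {a : Action C B S V D}
    (h : IsSoloAction δ Bl c a) : IsActionOf c a := by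
  cases a <;> simp_all [IsSoloAction, IsActionOf]

theorem IsSoloAction.mono {δ : B → S} {Bl Bl' : Finset S} {c : C} {x : Action C B S V D}
    (h : IsSoloAction δ Bl c x) (hBl : Bl' ⊆ Bl) : IsSoloAction δ Bl' c x := by
  cases x with
  | trigger => exact h
  | respond => exact ⟨h.1, fun hb => h.2 (hBl hb)⟩
  | _ => exact h.elim

end Prefix

namespace Emulation

variable {C : Type uC} {B : Type uB} {S : Type uS} {V : Type uV} {D : Type uD}
  {A : Emulation.{uC, uB, uV, uD, uT} C B V D} {δ : B → S} {W : Finset C}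

/-- A run which at each tick `n` executes an action with property `G n` if there is one. -/
theorem exists_greedy (δ : B → S) (W : Finset C) (G : ℕ → Action C B S V D → Prop) :
    ∃ ρ : ℕ → Option (Action C B S V D), ∀ n,
      (∀ a, ρ n = some a → G n a ∧ MemEnabled δ W (memAfter (A.initMem S) (prefixOf ρ n)) a) ∧
      (ρ n = none → ∀ a, G n a → ¬ MemEnabled δ W (memAfter (A.initMem S) (prefixOf ρ n)) a) := by
  classical
  let act (n : ℕ) (l : List (Action C B S V D)) : Option (Action C B S V D) :=
    if h : ∃ a, G n a ∧ MemEnabled δ W (memAfter (A.initMem S) l) a then some h.choose else none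
  let H : ℕ → List (Action C B S V D) := fun n => Nat.rec [] (fun n l => l ++ (act n l).toList) n
  have hH (n) : prefixOf (fun n => act n (H n)) n = H n := by
    induction n with
    | zero => rfl
    | succ n ih => rw [prefixOf_succ, ih]
  refine ⟨fun n => act n (H n), fun n => ?_⟩
  rw [hH]
  constructor
  · intro a ha
    simp only [act] at ha
    split_ifs at ha with h
    rw [Option.some.injEq] at ha
    exact ha ▸ h.choose_spec
  · intro hn a hG ha
    simp only [act] at hn
    split_ifs at hn with h
    exact h ⟨a, hG, ha⟩

theorem memSteps_prefixOf {ρ : ℕ → Option (Action C B S V D)}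
    (h : ∀ n a, ρ n = some a → MemEnabled δ W (memAfter (A.initMem S) (prefixOf ρ n)) a) (n : ℕ) :
    MemSteps δ W (A.initMem S) (prefixOf ρ n) := by
  induction n with
  | zero => trivial
  | succ n ih =>
    rw [prefixOf_succ]
    cases hn : ρ n with
    | none => simpa using ih
    | some a => exact memSteps_append_singleton.2 ⟨ih, h n a hn⟩

/-- The configurations agree except that `Y` has more crashes. -/
structure LessCrashed (X Y : A.MemConfig S) : Prop where
  eq : Y = { X with cfg := { X.cfg with
    crashedClients := Y.cfg.crashedClients, crashedServers := Y.cfg.crashedServers } }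
  clients : X.cfg.crashedClients ⊆ Y.cfg.crashedClients
  servers : X.cfg.crashedServers ⊆ Y.cfg.crashedServers

theorem LessCrashed.refl (X : A.MemConfig S) : LessCrashed X X := ⟨rfl, subset_rfl, subset_rfl⟩

theorem LessCrashed.crashClient {X Y : A.MemConfig S} (h : LessCrashed X Y) (c : C) :
    LessCrashed X (memApply Y (.crashClient c)) := by
  obtain ⟨h₁, h₂, h₃⟩ := h
  rw [h₁]
  exact ⟨rfl, fun _ hx => Or.inl (h₂ hx), h₃⟩

theorem LessCrashed.crashServer {X Y : A.MemConfig S} (h : LessCrashed X Y) (s : S) :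
    LessCrashed X (memApply Y (.crashServer s)) := by
  obtain ⟨h₁, h₂, h₃⟩ := h
  rw [h₁]
  exact ⟨rfl, h₂, fun _ hx => Or.inl (h₃ hx)⟩

theorem LessCrashed.crashServers {X Y : A.MemConfig S} (h : LessCrashed X Y) (L : List S) :
    LessCrashed X (memAfter Y (L.map .crashServer)) := by
  induction L generalizing Y with
  | nil => exact h
  | cons s L ih => exact ih (h.crashServer s)

theorem memSteps_crashServers (X : A.MemConfig S) (L : List S) :
    MemSteps δ W X (L.map .crashServer) := by
  induction L generalizing X with
  | nil => trivial
  | cons s L ih => exact ⟨⟨trivial, by simp⟩, ih _⟩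

/-- Crashes only disable actions. Together with `LessCrashed.memApply`, this allows the crashes to
be erased from a run. -/
theorem LessCrashed.memEnabled {X Y : A.MemConfig S} (h : LessCrashed X Y)
    {a : Action C B S V D} (ha : MemEnabled δ W Y a) : MemEnabled δ W X a := by
  obtain ⟨h₁, h₂, h₃⟩ := h
  generalize Y.cfg.crashedClients = cc at *
  generalize Y.cfg.crashedServers = cs at *
  subst h₁
  refine ⟨?_, ha.2⟩
  have ha := ha.1
  cases a
  · exact ⟨fun hx => ha.1 (h₂ hx), ha.2⟩
  · exact ⟨fun hx => ha.1 (h₂ hx), ha.2⟩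
  · exact ⟨fun hx => ha.1 (h₂ hx), ha.2⟩
  · exact ⟨fun hx => ha.1 (h₂ hx), fun hx => ha.2.1 (h₃ hx), ha.2.2⟩
  · trivial
  · trivial

theorem LessCrashed.memApply {X Y : A.MemConfig S} (h : LessCrashed X Y) {c : C}
    {a : Action C B S V D} (ha : IsActionOf c a) : LessCrashed (memApply X a) (memApply Y a) := by
  obtain ⟨h₁, h₂, h₃⟩ := h
  rw [h₁]
  cases a <;> first | exact ha.elim | exact ⟨rfl, h₂, h₃⟩

theorem pending_of_forall_not_respond {ρ : ℕ → Option (Action C B S V D)} {c : C} {i : ℕ} {b : B}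
    (hr : ∀ t a, ρ t ≠ some (.respond c i b a)) {t : ℕ}
    (ht : (c, i, b) ∈ (memAfter (A.initMem S) (prefixOf ρ t)).cfg.pending) {n : ℕ} (hn : t ≤ n) :
    (c, i, b) ∈ (memAfter (A.initMem S) (prefixOf ρ n)).cfg.pending := by
  induction n, hn using Nat.le_induction with
  | base => exact ht
  | succ n hn ih =>
    rw [prefixOf_succ]
    rcases h : ρ n with _ | a
    · simpa using ih
    · rw [memAfter_append]
      change (c, i, b) ∈ (A.apply _ a).pending
      rcases a with _ | _ | _ | ⟨c', i', b', r⟩ | _ | _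
      · exact ih
      · exact ih
      · exact Or.inl ih
      · refine ⟨ih, ?_⟩
        simp only [Set.mem_singleton_iff, Prod.mk.injEq]
        rintro ⟨rfl, rfl, rfl⟩
        exact hr n r h
      · exact ih
      · exact ih

/-- The servers in `Bl` and all clients other than `c` are crashed in a fair timed run that extends
`l₀`. There the operation of `c` has no correct competitor, so it returns. Erasing the crashes gives
a run in which the servers in `Bl` are only silent during `K`. -/
theorem ObstructionFree.exists_solo [Countable C] {f : ℕ} (hA : A.ObstructionFree δ W f)
    {l₀ : List (Action C B S V D)} (h₀ : MemSteps δ W (A.initMem S) l₀)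
    (hcrash : ∀ a ∈ l₀, ∃ c, IsActionOf c a) {c : C} {m : ℕ} {o : RegOp V}
    (hinv : Action.invoke c m o ∈ l₀) (huniq : ∀ m' o', Action.invoke c m' o' ∈ l₀ → m' = m)
    (hret : ∀ m' a, Action.ret c m' a ∉ l₀)
    (hnum : (memAfter (A.initMem S) l₀).cfg.numInvoked c = m + 1)
    (Bl : Finset S) (hBl : Bl.card ≤ f) :
    ∃ K a, (∀ x ∈ K, IsSoloAction δ Bl c x) ∧
      MemSteps δ W (A.initMem S) (l₀ ++ K ++ [.ret c m a]) := by
  classical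
  have := Encodable.ofCountable C
  set l₁ : List (Action C B S V D) := l₀ ++ Bl.toList.map .crashServer with hl₁
  set N := l₁.length with hN
  have h₁ : MemSteps δ W (A.initMem S) l₁ :=
    memSteps_append.2 ⟨h₀, memSteps_crashServers _ _⟩
  -- The first `N` ticks replay `l₁`. Later ticks cycle through crashing another client, a local
  -- step of `c`, and a response to `c`. Unpairing `n / 3` makes every client code and every
  -- operation number come up at arbitrarily late ticks.
  obtain ⟨ρ, hρ⟩ := exists_greedy (A := A) δ W fun n a =>
    (n < N ∧ l₁[n]? = some a) ∨ (N ≤ n ∧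
      ((n % 3 = 0 ∧ ∃ c', Encodable.encode c' = (n / 3).unpair.2 ∧ c' ≠ c ∧ a = .crashClient c') ∨
       (n % 3 = 1 ∧ IsLocalActionOf c a) ∨
       (n % 3 = 2 ∧ ∃ b r, a = .respond c (n / 3).unpair.2 b r ∧ δ b ∉ Bl)))
  have hsteps : ∀ n, MemSteps δ W (A.initMem S) (prefixOf ρ n) :=
    memSteps_prefixOf fun n a ha => ((hρ n).1 a ha).2
  have hscript : ∀ n ≤ N, prefixOf ρ n = l₁.take n ∧ ∀ m < n, ρ m = l₁[m]? := by
    intro n hn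
    induction n with
    | zero => exact ⟨by simp [prefixOf], by simp⟩
    | succ n ih =>
      obtain ⟨ih₁, ih₂⟩ := ih (by omega)
      have hlt : n < l₁.length := by omega
      have hn' : ρ n = l₁[n]? := by
        cases h : ρ n with
        | none =>
          refine absurd ?_ ((hρ n).2 h l₁[n] (Or.inl ⟨hlt, by simp⟩))
          rw [ih₁]
          have h₁' := h₁
          rw [← List.take_append_drop n l₁, memSteps_append, List.drop_eq_getElem_cons hlt] at h₁'
          exact h₁'.2.1
        | some a =>
          rcases ((hρ n).1 a h).1 with h' | h'
          · exact h'.2.symm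
          · omega
      refine ⟨?_, fun m hm => ?_⟩
      · rw [prefixOf_succ, ih₁, hn', List.take_add_one]
      · rcases Nat.lt_succ_iff_lt_or_eq.1 hm with hm | rfl
        · exact ih₂ m hm
        · exact hn'
  have hlow {t} (ht : t < N) : ρ t = l₁[t]? := (hscript N le_rfl).2 t ht
  have hmem {t a} (ht : t < N) (ha : ρ t = some a) : a ∈ l₁ :=
    List.mem_of_getElem? (hlow ht ▸ ha)
  have hget {a} (ha : a ∈ l₁) : ∃ t < N, ρ t = some a := by
    obtain ⟨t, ht, rfl⟩ := List.mem_iff_getElem.1 ha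
    exact ⟨t, ht, by rw [hlow ht]; simp⟩
  have hhigh {t a} (ht : N ≤ t) (ha : ρ t = some a) :
      (∃ c', c' ≠ c ∧ a = .crashClient c') ∨ IsLocalActionOf c a ∨
        ∃ i b r, a = .respond c i b r ∧ δ b ∉ Bl := by
    rcases ((hρ t).1 a ha).1 with h | ⟨-, ⟨-, c', -, h⟩ | ⟨-, h⟩ | ⟨-, b, r, h⟩⟩
    · omega
    · exact Or.inl ⟨c', h⟩
    · exact Or.inr (Or.inl h)
    · exact Or.inr (Or.inr ⟨_, b, r, h⟩)
  have hmem₁ {a} (ha : a ∈ l₁) : a ∈ l₀ ∨ ∃ s ∈ Bl, a = .crashServer s := by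
    rw [hl₁, List.mem_append] at ha
    refine ha.imp_right fun ha => ?_
    obtain ⟨s, hs, rfl⟩ := List.mem_map.1 ha
    exact ⟨s, by simpa using hs, rfl⟩
  have hcorrect : CorrectClient ρ c := by
    intro t ht
    rcases lt_or_ge t N with h | h
    · rcases hmem₁ (hmem h ht) with h | ⟨s, -, h⟩
      · obtain ⟨c', hc'⟩ := hcrash _ h
        exact hc'
      · simp at h
    · rcases hhigh h ht with ⟨c', h, h'⟩ | h | ⟨i, b, r, h, -⟩
      · simp only [Action.crashClient.injEq] at h'
        exact h h'.symm
      · exact h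
      · simp at h
  have hcorrect' {c'} (hc' : CorrectClient ρ c') : c' = c := by
    by_contra hne
    -- At this tick the crash of `c'` is due, and a crash is always enabled.
    set n := 3 * Nat.pair N (Encodable.encode c') with hn
    have hNn : N ≤ n := by have := Nat.left_le_pair N (Encodable.encode c'); omega
    have hn3 : n / 3 = Nat.pair N (Encodable.encode c') := by omega
    have hG : n % 3 = 0 := by omega
    cases h : ρ n with
    | none =>
      refine (hρ n).2 h (.crashClient c') (Or.inr ⟨hNn, Or.inl ⟨hG, c', ?_, hne, rfl⟩⟩)
        ⟨trivial, by simp⟩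
      simp [hn3]
    | some a =>
      rcases ((hρ n).1 a h).1 with h' | ⟨-, ⟨-, c'', h', -, rfl⟩ | ⟨h', -⟩ | ⟨h', -⟩⟩
      · omega
      · rw [hn3, Nat.unpair_pair, Encodable.encode_inj] at h'
        exact hc' n (h' ▸ h)
      · omega
      · omega
  have hserver {s} : CorrectServer ρ s ↔ s ∉ Bl := by
    constructor
    · intro hs hsB
      obtain ⟨t, -, ht⟩ := hget (a := .crashServer s)
        (by rw [hl₁, List.mem_append]; right; simpa using hsB)
      exact hs t ht
    · intro hs t ht
      rcases lt_or_ge t N with h | h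
      · rcases hmem₁ (hmem h ht) with h | ⟨s', hs', h⟩
        · obtain ⟨c', hc'⟩ := hcrash _ h
          exact hc'
        · simp only [Action.crashServer.injEq] at h
          exact hs (h ▸ hs')
      · rcases hhigh h ht with ⟨c', h, h'⟩ | h | ⟨i, b, r, h, -⟩
        · simp at h'
        · exact h
        · simp at h
  have hcrashed (n) : c ∉ (memAfter (A.initMem S) (prefixOf ρ n)).cfg.crashedClients ∧
      (memAfter (A.initMem S) (prefixOf ρ n)).cfg.crashedServers ⊆ Bl := by
    induction n with
    | zero => simp [prefixOf, initMem, initConfig]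
    | succ n ih =>
      rw [prefixOf_succ]
      rcases h : ρ n with _ | a
      · simpa using ih
      · rw [memAfter_append]
        change _ ∉ (A.apply _ a).crashedClients ∧ (A.apply _ a).crashedServers ⊆ _
        rcases a with _ | _ | _ | _ | c' | s
        · exact ih
        · exact ih
        · exact ih
        · exact ih
        · refine ⟨?_, ih.2⟩
          rintro (h' | h')
          · exact ih.1 h'
          · exact hcorrect n (h'.symm ▸ h)
        · refine ⟨ih.1, ?_⟩
          rintro s' (h' | h')
          · exact ih.2 h'
          · by_contra hs
            exact hserver.2 hs n (h'.symm ▸ h)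
  have hcfg (l : List (Action C B S V D)) : A.configAfter S l = (memAfter (A.initMem S) l).cfg :=
    by rw [cfg_memAfter]; rfl
  have hfair : A.IsFair δ W ρ := by
    constructor
    · intro t c' i b o' ht hc' hb
      obtain rfl := hcorrect' hc'
      rw [hserver] at hb
      by_contra! hr
      have hr : ∀ t a, ρ t ≠ some (.respond c' i b a) := hr
      have hp : (c', i, b) ∈ (memAfter (A.initMem S) (prefixOf ρ (t + 1))).cfg.pending := by
        rw [prefixOf_succ, ht, memAfter_append]
        exact Or.inr rfl
      -- A tick after the trigger at which the response to operation number `i` is due. If that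
      -- operation is still pending, then a response is enabled, and it must come from `b` since a
      -- number is pending at only one register.
      set n := 3 * Nat.pair (N + t + 1) i + 2 with hn
      have hNn : N + t + 1 ≤ n := by have := Nat.left_le_pair (N + t + 1) i; omega
      have hn3 : n / 3 = Nat.pair (N + t + 1) i := by omega
      have hpn := pending_of_forall_not_respond hr hp (n := n) (by omega)
      cases h : ρ n with
      | none =>
        set X := memAfter (A.initMem S) (prefixOf ρ n)
        refine (hρ n).2 h (.respond c' i b ((X.opOf (c', i)).expectedResp (X.mem b)))
          (Or.inr ⟨by omega, Or.inr (Or.inr ⟨by omega, b, (X.opOf (c', i)).expectedResp (X.mem b), ?_, hb⟩)⟩)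
          ⟨⟨(hcrashed n).1, fun h => hb ((hcrashed n).2 h), hpn⟩, ?_⟩
        · simp [hn3]
        · intro c₁ i₁ b₁ r₁ heq
          simp only [Action.respond.injEq] at heq
          obtain ⟨rfl, rfl, rfl, rfl⟩ := heq
          rfl
      | some a =>
        rcases ((hρ n).1 a h).1 with h' | ⟨-, ⟨h', -⟩ | ⟨h', -⟩ | ⟨-, b', r, rfl, hb'⟩⟩
        · omega
        · omega
        · omega
        · rw [hn3, Nat.unpair_pair] at h
          have hen := ((hρ n).1 _ h).2.1
          obtain rfl := (hsteps n).invariant.pending_unique _ _ _ _ hpn hen.2.2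
          exact hr n r h
    · intro c' hc' t
      obtain rfl := hcorrect' hc'
      refine ⟨3 * (N + t) + 1, by omega, ?_⟩
      cases h : ρ (3 * (N + t) + 1) with
      | none =>
        right
        intro a ha hen
        rw [hcfg] at hen
        refine (hρ _).2 h a (Or.inr ⟨by omega, Or.inr (Or.inl ⟨by omega, ha⟩)⟩) ⟨hen, ?_⟩
        rintro _ _ _ _ rfl
        exact ha.elim
      | some a =>
        left
        refine ⟨a, rfl, ?_⟩
        rcases ((hρ _).1 a h).1 with h' | ⟨-, ⟨h', -⟩ | ⟨-, h'⟩ | ⟨h', -⟩⟩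
        · omega
        · omega
        · exact h'
        · omega
  have hinvoke {t c' m' o'} (ht : ρ t = some (.invoke c' m' o')) :
      Action.invoke c' m' o' ∈ l₀ := by
    rcases lt_or_ge t N with h | h
    · rcases hmem₁ (hmem h ht) with h | ⟨s', hs', h⟩
      · exact h
      · simp at h
    · rcases hhigh h ht with ⟨c', h, h'⟩ | h | ⟨i, b, r, h, -⟩
      · simp at h'
      · exact h.elim
      · simp at h
  obtain ⟨t₀, -, ht₀⟩ := hget (List.mem_append_left _ hinv)
  have hreturn : ∃ t m' a, ρ t = some (.ret c m' a) := by
    have hfew : {s | ¬ CorrectServer ρ s}.encard ≤ f := by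
      simp only [hserver, not_not, Finset.setOfPred_mem, Set.encard_coe_eq_coe_finsetCard]
      exact_mod_cast hBl
    have halone : ∀ t' c' m' o', ρ t' = some (.invoke c' m' o') → CorrectClient ρ c' →
        (c', m') ≠ (c, m) → HighPrecedes ρ (c, m) (c', m') ∨ HighPrecedes ρ (c', m') (c, m) := by
      intro t' c' m' o' ht' hc' hne
      obtain rfl := hcorrect' hc'
      exact absurd (by rw [huniq _ _ (hinvoke ht')]) hne
    obtain ⟨t', a, ht'⟩ :=
      hA ρ (fun n => (hsteps n).isRun) hfair hfew t₀ c m o ht₀ hcorrect halone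
    exact ⟨t', m, a, ht'⟩
  -- The first return of `c` is taken, so that `c` only triggers and receives responses in between.
  -- That its number is `m` follows later from the count of invocations.
  obtain ⟨m', a, ht⟩ := Nat.find_spec hreturn
  set t := Nat.find hreturn
  have hmin {t'} (h : t' < t) (m' a) : ρ t' ≠ some (.ret c m' a) := fun h' =>
    Nat.find_min hreturn h ⟨m', a, h'⟩
  have hNt : N ≤ t := by
    by_contra! h
    rcases hmem₁ (hmem h ht) with h | ⟨s', hs', h⟩
    · exact hret _ _ h
    · simp at h
  -- The list `K` collects the actions of `ρ` after tick `N` except the crashes; the two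
  -- configurations then differ only in crashes.
  have key : ∀ n, N + n ≤ t → ∃ K, (∀ x ∈ K, IsSoloAction δ Bl c x) ∧
      MemSteps δ W (A.initMem S) (l₀ ++ K) ∧
      LessCrashed (memAfter (A.initMem S) (l₀ ++ K))
        (memAfter (A.initMem S) (prefixOf ρ (N + n))) ∧
      (memAfter (A.initMem S) (l₀ ++ K)).cfg.numInvoked c = m + 1 := by
    intro n hn
    induction n with
    | zero =>
      refine ⟨[], by simp, by simpa using h₀, ?_, by simpa using hnum⟩
      rw [add_zero, (hscript N le_rfl).1, hN, List.take_length, hl₁, List.append_nil,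
        memAfter_append]
      exact (LessCrashed.refl _).crashServers _
    | succ n ih =>
      obtain ⟨K, hK, hst, hless, hnumK⟩ := ih (by omega)
      rw [← add_assoc, prefixOf_succ]
      cases h : ρ (N + n) with
      | none => exact ⟨K, hK, hst, by simpa using hless, hnumK⟩
      | some x =>
        rw [Option.toList_some, memAfter_append]
        have hen := hless.memEnabled ((hρ _).1 x h).2
        have extend (hx : IsSoloAction δ Bl c x) : ∃ K, (∀ x ∈ K, IsSoloAction δ Bl c x) ∧
            MemSteps δ W (A.initMem S) (l₀ ++ K) ∧
            LessCrashed (memAfter (A.initMem S) (l₀ ++ K))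
              (memAfter (memAfter (A.initMem S) (prefixOf ρ (N + n))) [x]) ∧
            (memAfter (A.initMem S) (l₀ ++ K)).cfg.numInvoked c = m + 1 := by
          refine ⟨K ++ [x], ?_, ?_, ?_, ?_⟩
          · intro y hy
            rw [List.mem_append, List.mem_singleton] at hy
            rcases hy with hy | rfl
            exacts [hK _ hy, hx]
          · rw [← List.append_assoc, memSteps_append_singleton]
            exact ⟨hst, hen⟩
          · rw [← List.append_assoc, memAfter_append]
            exact hless.memApply hx.isActionOf
          · rw [← List.append_assoc, memAfter_append]
            cases x <;> first | exact hx.elim | exact hnumK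
        rcases hhigh (by omega) h with ⟨c', -, rfl⟩ | h' | ⟨i, b, r, rfl, hb⟩
        · exact ⟨K, hK, hst, hless.crashClient c', hnumK⟩
        · cases x with
          | trigger c' i b o' => exact extend h'
          | ret c' m'' a' =>
            obtain rfl : c' = c := h'
            exact absurd h (hmin (by omega) _ _)
          | _ => exact h'.elim
        · exact extend ⟨rfl, hb⟩
  obtain ⟨K, hK, hst, hless, hnumK⟩ := key (t - N) (by omega)
  rw [Nat.add_sub_cancel' hNt] at hless
  have hen := hless.memEnabled ((hρ _).1 _ ht).2
  obtain rfl : m' = m := by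
    have := hen.1.2.2.1
    omega
  exact ⟨K, a, hK, memSteps_append_singleton.2 ⟨hst, hen⟩⟩

end Emulation

end RegisterEmulation

namespace RegisterEmulation

/-! ### Complete sequential schedules -/

section SequentialSchedules

variable {ι : Type uC} {V : Type uV}

/-- The schedule in which the operations of `M` are executed one after the other. -/
def seqSchedule (M : List (SeqOp ι V)) : List (SchedEvent ι V) :=
  M.flatMap fun e => [.inv e.id e.op, .res e.id e.resp]

theorem inv_mem_seqSchedule {M : List (SeqOp ι V)} {i : ι} {o : RegOp V} :
    SchedEvent.inv i o ∈ seqSchedule M ↔ ∃ e ∈ M, e.id = i ∧ e.op = o := by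
  simp [seqSchedule, eq_comm]

theorem res_mem_seqSchedule {M : List (SeqOp ι V)} {i : ι} {a : RegResp V} :
    SchedEvent.res i a ∈ seqSchedule M ↔ ∃ e ∈ M, e.id = i ∧ e.resp = a := by
  simp [seqSchedule, eq_comm]

theorem pair_sublist_or {α : Type*} {a b : α} {l : List α} (ha : a ∈ l) (hb : b ∈ l)
    (hne : a ≠ b) : [a, b].Sublist l ∨ [b, a].Sublist l := by
  induction l with
  | nil => simp at ha
  | cons x l ih =>
    rcases List.mem_cons.1 ha with ha' | ha' <;> rcases List.mem_cons.1 hb with hb' | hb'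
    · exact absurd (ha'.trans hb'.symm) hne
    · exact Or.inl (ha' ▸ (List.singleton_sublist.2 hb').cons_cons _)
    · exact Or.inr (hb' ▸ (List.singleton_sublist.2 ha').cons_cons _)
    · exact (ih ha' hb').imp (·.cons _) (·.cons _)

theorem not_pair_sublist_of_nodup {α : Type*} {a b : α} {l : List α} (hl : l.Nodup)
    (hab : [a, b].Sublist l) : ¬ [b, a].Sublist l := by
  induction l with
  | nil => simp at hab
  | cons x l ih =>
    rw [List.nodup_cons] at hl
    intro hba
    cases hab with
    | cons _ hab =>
      cases hba with
      | cons _ hba => exact ih hl.2 hab hba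
      | cons_cons _ hba => exact hl.1 (hab.subset (by simp))
    | cons_cons _ hab =>
      cases hba with
      | cons _ hba => exact hl.1 (hba.subset (by simp))
      | cons_cons _ hba => exact hl.1 (hba.subset (by simp))

theorem precedes_seqSchedule {M : List (SeqOp ι V)} {e e' : SeqOp ι V}
    (h : [e, e'].Sublist M) : Precedes (seqSchedule M) e.id e'.id := by
  refine ⟨e.resp, e'.op, List.Sublist.trans ?_ (h.flatMap _)⟩
  simp

theorem not_concurrent_seqSchedule {M : List (SeqOp ι V)} {e e' : SeqOp ι V}
    (he : e ∈ M) (he' : e' ∈ M) (hne : e ≠ e') : ¬ Concurrent (seqSchedule M) e.id e'.id := by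
  rintro ⟨h, h'⟩
  rcases pair_sublist_or he he' hne with hs | hs
  · exact h (precedes_seqSchedule hs)
  · exact h' (precedes_seqSchedule hs)

/-- All operations are complete, so `L` is a permutation of `M`; they are totally ordered by
precedence, so the permutation is trivial. -/
theorem IsLinearization.eq_of_seqSchedule {v : V} {M L : List (SeqOp ι V)}
    (hM : (M.map SeqOp.id).Nodup) (h : IsLinearization v (seqSchedule M) L) : L = M := by
  have hinj {e e'} (he : e ∈ M) (he' : e' ∈ M) (hid : e.id = e'.id) : e = e' :=
    List.inj_on_of_nodup_map hM he he' hid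
  have hsub {e} (he : e ∈ L) : e ∈ M := by
    obtain ⟨e', he', hid, hop⟩ := inv_mem_seqSchedule.1 (h.invoked e he)
    have hr := h.resp_eq e he e'.resp (res_mem_seqSchedule.2 ⟨e', he', hid, rfl⟩)
    obtain rfl : e = e' := by cases e; cases e'; simp_all
    exact he'
  have hsup {e} (he : e ∈ M) : e ∈ L := by
    obtain ⟨e', he', hid⟩ := List.mem_map.1
      (h.complete e.id e.resp (res_mem_seqSchedule.2 ⟨e, he, rfl, rfl⟩))
    rwa [hinj (hsub he') he hid] at he'
  have hperm : L.Perm M :=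
    (List.perm_ext_iff_of_nodup h.nodup.of_map hM.of_map).2 fun e => ⟨hsub, hsup⟩
  refine hperm.eq_of_pairwise (le := fun e e' => [e, e'].Sublist M) ?_ ?_ ?_
  · intro a b _ _ hab hba
    exact absurd hba (not_pair_sublist_of_nodup hM.of_map hab)
  · rw [List.pairwise_iff_forall_sublist]
    intro a b hab
    have hne : a ≠ b := by
      rintro rfl
      have := h.nodup.of_map.sublist hab
      simp at this
    have ha := hab.subset (show a ∈ [a, b] by simp)
    have hb := hab.subset (show b ∈ [a, b] by simp)
    refine (pair_sublist_or (hsub ha) (hsub hb) hne).resolve_right fun hba => ?_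
    exact not_pair_sublist_of_nodup h.nodup (hab.map SeqOp.id)
      (h.order _ (List.mem_map_of_mem hb) _ (List.mem_map_of_mem ha) (precedes_seqSchedule hba))
  · exact List.pairwise_iff_forall_sublist.2 id

/-- In a sequential schedule of writes followed by one read nothing is concurrent and the
restriction drops nothing, so the schedule is its own only linearization. -/
theorem WSSafeSchedule.read_eq {v₀ : V} {M : List (SeqOp ι V)} {rd : ι} {a : RegResp V}
    (hM : ((M ++ [(⟨rd, .read, a⟩ : SeqOp ι V)]).map SeqOp.id).Nodup) (hw : ∀ e ∈ M, ∃ v, e.op = .write v)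
    (h : WSSafeSchedule v₀ (seqSchedule (M ++ [⟨rd, .read, a⟩]))) :
    a = .val (finalValue v₀ M) := by
  set M' := M ++ [⟨rd, .read, a⟩] with hM'
  have hrd : (⟨rd, .read, a⟩ : SeqOp ι V) ∈ M' := by simp [hM']
  have hwrites {i} (hi : i ∈ writes (seqSchedule M')) : ∃ e ∈ M', e.id = i ∧ ∃ v, e.op = .write v :=
    let ⟨v, hv⟩ := hi
    let ⟨e, he, hid, ho⟩ := inv_mem_seqSchedule.1 hv
    ⟨e, he, hid, v, ho⟩
  obtain ⟨L, hL⟩ := h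
    (by
      intro i hi j hj hij
      obtain ⟨e, he, rfl, -⟩ := hwrites hi
      obtain ⟨e', he', rfl, -⟩ := hwrites hj
      exact not_concurrent_seqSchedule he he' fun h => hij (h ▸ rfl))
    rd ⟨inv_mem_seqSchedule.2 ⟨_, hrd, rfl, rfl⟩, a, res_mem_seqSchedule.2 ⟨_, hrd, rfl, rfl⟩⟩
    (by
      intro w hw
      obtain ⟨e, he, rfl, v, hv⟩ := hwrites hw
      refine not_concurrent_seqSchedule hrd he ?_
      rintro rfl
      simp at hv)
  have hres : restrict (seqSchedule M') (writes (seqSchedule M') ∪ {rd}) = seqSchedule M' := by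
    rw [restrict, List.filter_eq_self]
    intro x hx
    obtain ⟨e, he, hxe⟩ := List.mem_flatMap.1 hx
    have hid : x.opId = e.id := by
      simp only [List.mem_cons, List.not_mem_nil, or_false] at hxe
      rcases hxe with rfl | rfl <;> rfl
    simp only [hid, decide_eq_true_eq]
    rcases List.mem_append.1 he with he' | he'
    · obtain ⟨v, hv⟩ := hw e he'
      exact Or.inl ⟨v, inv_mem_seqSchedule.2 ⟨e, he, rfl, hv⟩⟩
    · rw [List.mem_singleton.1 he']
      exact Or.inr rfl
  rw [hres] at hL
  have hspec := hL.spec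
  rw [hL.eq_of_seqSchedule hM, hM', seqSpec_append_singleton] at hspec
  exact hspec.2

end SequentialSchedules

namespace Emulation

variable {C : Type uC} {B : Type uB} {S : Type uS} {V : Type uV} {D : Type uD}
  {A : Emulation.{uC, uB, uV, uD, uT} C B V D} {δ : B → S} {W : Finset C}

/-! ### Local views of clients -/

/-- The configurations look the same to client `c`. -/
structure LocalEq (c : C) (X Y : A.MemConfig S) : Prop where
  state : X.cfg.state c = Y.cfg.state c
  numInvoked : X.cfg.numInvoked c = Y.cfg.numInvoked c
  numTriggered : X.cfg.numTriggered c = Y.cfg.numTriggered c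
  busy : c ∈ X.cfg.busy ↔ c ∈ Y.cfg.busy
  crashed : c ∈ X.cfg.crashedClients ↔ c ∈ Y.cfg.crashedClients
  pending : ∀ i b, (c, i, b) ∈ X.cfg.pending ↔ (c, i, b) ∈ Y.cfg.pending
  opOf : ∀ i, X.opOf (c, i) = Y.opOf (c, i)

theorem LocalEq.refl (c : C) (X : A.MemConfig S) : LocalEq c X X :=
  ⟨rfl, rfl, rfl, Iff.rfl, Iff.rfl, fun _ _ => Iff.rfl, fun _ => rfl⟩

theorem LocalEq.symm {c : C} {X Y : A.MemConfig S} (h : LocalEq c X Y) : LocalEq c Y X :=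
  ⟨h.1.symm, h.2.symm, h.3.symm, h.4.symm, h.5.symm, fun i b => (h.6 i b).symm,
    fun i => (h.7 i).symm⟩

theorem LocalEq.trans {c : C} {X Y Z : A.MemConfig S} (h : LocalEq c X Y) (h' : LocalEq c Y Z) :
    LocalEq c X Z :=
  ⟨h.1.trans h'.1, h.2.trans h'.2, h.3.trans h'.3, h.4.trans h'.4, h.5.trans h'.5,
    fun i b => (h.6 i b).trans (h'.6 i b), fun i => (h.7 i).trans (h'.7 i)⟩

theorem localEq_memApply {c c' : C} (hc : c ≠ c') (X : A.MemConfig S) {a : Action C B S V D}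
    (ha : IsActionOf c' a) : LocalEq c X (memApply X a) := by
  cases a <;> first | exact ha.elim | skip
  all_goals
    obtain rfl : _ = c' := ha
    constructor <;> simp [memApply, apply, hc]

theorem localEq_memAfter {c : C} (X : A.MemConfig S) {l : List (Action C B S V D)}
    (hl : ∀ a ∈ l, ∃ c', c ≠ c' ∧ IsActionOf c' a) : LocalEq c X (memAfter X l) := by
  induction l generalizing X with
  | nil => exact LocalEq.refl c X
  | cons a l ih =>
    obtain ⟨c', hc, ha⟩ := hl a (by simp)
    exact (localEq_memApply hc X ha).trans (ih _ fun a ha => hl a (by simp [ha]))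

/-- The configurations look the same to client `c`, and only registers of servers in `Bl` may
have different contents. -/
structure AgreeOff (δ : B → S) (Bl : Finset S) (c : C) (X Y : A.MemConfig S) : Prop where
  loc : LocalEq c X Y
  servers : X.cfg.crashedServers = Y.cfg.crashedServers
  mem : ∀ b, δ b ∉ Bl → X.mem b = Y.mem b

/-- An action of client `c` which is not a response from a server in `Bl`. -/
def IsActionOff (δ : B → S) (Bl : Finset S) (c : C) (a : Action C B S V D) : Prop :=
  IsActionOf c a ∧ ∀ i b r, a = .respond c i b r → δ b ∉ Bl

theorem AgreeOff.memEnabled {Bl : Finset S} {c : C} {X Y : A.MemConfig S}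
    (h : AgreeOff δ Bl c X Y) {a : Action C B S V D} (hc : IsActionOff δ Bl c a)
    (ha : MemEnabled δ W X a) : MemEnabled δ W Y a := by
  obtain ⟨⟨h₁, h₂, h₃, h₄, h₅, h₆, h₇⟩, h₈, h₉⟩ := h
  obtain ⟨hc, hB⟩ := hc
  obtain ⟨ha, hr⟩ := ha
  cases a with
  | crashClient => exact hc.elim
  | crashServer => exact hc.elim
  | respond c' i b r =>
    obtain rfl : c' = c := hc
    refine ⟨⟨h₅.not.1 ha.1, h₈ ▸ ha.2.1, (h₆ _ _).1 ha.2.2⟩, ?_⟩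
    intro c₁ i₁ b₁ r₁ heq
    have := hr c₁ i₁ b₁ r₁ heq
    simp only [Action.respond.injEq] at heq
    obtain ⟨rfl, rfl, rfl, rfl⟩ := heq
    rw [this, h₇, h₉ _ (hB _ _ _ rfl)]
  | invoke c' m o =>
    obtain rfl : c' = c := hc
    exact ⟨⟨h₅.not.1 ha.1, h₄.not.1 ha.2.1, h₂ ▸ ha.2.2.1, ha.2.2.2⟩, by simp⟩
  | ret c' m o =>
    obtain rfl : c' = c := hc
    exact ⟨⟨h₅.not.1 ha.1, h₄.1 ha.2.1, h₂ ▸ ha.2.2.1, h₁ ▸ ha.2.2.2⟩, by simp⟩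
  | trigger c' i b o =>
    obtain rfl : c' = c := hc
    exact ⟨⟨h₅.not.1 ha.1, h₃ ▸ ha.2.1, h₁ ▸ ha.2.2⟩, by simp⟩

theorem AgreeOff.memApply {Bl : Finset S} {c : C} {X Y : A.MemConfig S}
    (h : AgreeOff δ Bl c X Y) {a : Action C B S V D} (hc : IsActionOff δ Bl c a) :
    AgreeOff δ Bl c (memApply X a) (memApply Y a) := by
  classical
  obtain ⟨⟨h₁, h₂, h₃, h₄, h₅, h₆, h₇⟩, h₈, h₉⟩ := h
  obtain ⟨hc, hB⟩ := hc
  cases a with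
  | crashClient => exact hc.elim
  | crashServer => exact hc.elim
  | respond c' i b r =>
    obtain rfl : c' = c := hc
    refine ⟨by constructor <;> simp_all [Emulation.memApply, apply], h₈, fun b' hb' => ?_⟩
    simp only [Emulation.memApply, Function.update_apply, h₇, h₉ _ (hB _ _ _ rfl), h₉ _ hb']
  | invoke c' m o =>
    obtain rfl : c' = c := hc
    exact ⟨by constructor <;> simp_all [Emulation.memApply, apply], h₈, h₉⟩
  | ret c' m o =>
    obtain rfl : c' = c := hc
    exact ⟨by constructor <;> simp_all [Emulation.memApply, apply], h₈, h₉⟩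
  | trigger c' i b o =>
    obtain rfl : c' = c := hc
    exact ⟨by constructor <;> simp_all [Emulation.memApply, apply, Function.update_apply], h₈, h₉⟩

/-- Indistinguishability: the client hears nothing from `Bl`, so its steps depend only on its local
view and on register contents that agree. -/
theorem AgreeOff.memSteps {Bl : Finset S} {c : C} {X Y : A.MemConfig S}
    (h : AgreeOff δ Bl c X Y) {l : List (Action C B S V D)} (hl : ∀ a ∈ l, IsActionOff δ Bl c a)
    (hX : MemSteps δ W X l) : MemSteps δ W Y l := by
  induction l generalizing X Y with
  | nil => trivial
  | cons a l ih =>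
    have ha := hl a (by simp)
    exact ⟨h.memEnabled ha hX.1, ih (h.memApply ha) (fun a ha => hl a (by simp [ha])) hX.2⟩

theorem crashedClients_memAfter {l : List (Action C B S V D)} (hl : ∀ a ∈ l, ∃ c, IsActionOf c a)
    (X : A.MemConfig S) : (memAfter X l).cfg.crashedClients = X.cfg.crashedClients := by
  induction l generalizing X with
  | nil => rfl
  | cons a l ih =>
    rw [memAfter_cons, ih fun a ha => hl a (by simp [ha])]
    obtain ⟨c, hc⟩ := hl a (by simp)
    cases a <;> first | exact hc.elim | rfl

theorem crashedServers_memAfter {l : List (Action C B S V D)} (hl : ∀ a ∈ l, ∃ c, IsActionOf c a)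
    (X : A.MemConfig S) : (memAfter X l).cfg.crashedServers = X.cfg.crashedServers := by
  induction l generalizing X with
  | nil => rfl
  | cons a l ih =>
    rw [memAfter_cons, ih fun a ha => hl a (by simp [ha])]
    obtain ⟨c, hc⟩ := hl a (by simp)
    cases a <;> first | exact hc.elim | rfl

theorem crashedIn_eq_empty {l : List (Action C B S V D)} (hl : ∀ a ∈ l, ∃ c, IsActionOf c a) :
    crashedIn l = ∅ :=
  Set.eq_empty_of_forall_notMem fun _ hs => let ⟨_, hc⟩ := hl _ hs; hc

/-! ### Responding to pending writes -/

/-- The responses to the pending writes in `P`. -/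
def flush (P : List (C × ℕ × B)) : List (Action C B S V D) :=
  P.map fun p => .respond p.1 p.2.1 p.2.2 .ack

theorem memSteps_flush {X : A.MemConfig S} (hC : X.cfg.crashedClients = ∅)
    (hS : X.cfg.crashedServers = ∅) {P : List (C × ℕ × B)} (hP : P.Nodup)
    (hpend : ∀ p ∈ P, p ∈ X.cfg.pending ∧ ∃ v, X.opOf (p.1, p.2.1) = .write v) :
    MemSteps δ W X (flush P) := by
  induction P generalizing X with
  | nil => trivial
  | cons p P ih =>
    rw [List.nodup_cons] at hP
    obtain ⟨hp, v, hv⟩ := hpend p (by simp)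
    refine ⟨⟨⟨by simp [hC], by simp [hS], hp⟩, ?_⟩, ih hC hS hP.2 fun q hq => ?_⟩
    · intro c i b r heq
      simp only [Action.respond.injEq] at heq
      obtain ⟨rfl, rfl, rfl, rfl⟩ := heq
      rw [hv]
      rfl
    · obtain ⟨hq₁, hq₂⟩ := hpend q (by simp [hq])
      exact ⟨⟨hq₁, by rintro rfl; exact hP.1 hq⟩, hq₂⟩

/-- A covered register ends up with the value of the last flushed write to it, whatever it held
before. Flushing thus erases all differences on covered registers. -/
theorem mem_flush {X Y : A.MemConfig S} {P : List (C × ℕ × B)}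
    (hX : ∀ p ∈ P, ∃ v, X.opOf (p.1, p.2.1) = .write v)
    (hop : ∀ p ∈ P, X.opOf (p.1, p.2.1) = Y.opOf (p.1, p.2.1)) {b : B}
    (hmem : (∀ p ∈ P, p.2.2 ≠ b) → X.mem b = Y.mem b) :
    (memAfter X (flush P)).mem b = (memAfter Y (flush P)).mem b := by
  classical
  induction P generalizing X Y with
  | nil => exact hmem (by simp)
  | cons p P ih =>
    refine ih (fun q hq => hX q (by simp [hq])) (fun q hq => hop q (by simp [hq])) fun hb => ?_
    obtain ⟨v, hv⟩ := hX p (by simp)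
    have hv' := hop p (by simp)
    rw [hv] at hv'
    simp only [memApply, Function.update_apply]
    split_ifs with hpb
    · rw [hv, ← hv']
      rfl
    · exact hmem fun q hq => by
        rcases List.mem_cons.1 hq with rfl | hq
        exacts [fun h => hpb h.symm, hb q hq]

theorem exists_isActionOf_flush {P : List (C × ℕ × B)} {a : Action C B S V D} (ha : a ∈ flush P) :
    ∃ p ∈ P, IsActionOf p.1 a := by
  obtain ⟨p, hp, rfl⟩ := List.mem_map.1 ha
  exact ⟨p, hp, rfl⟩

/-! ### Operations of fresh clients -/

theorem memSteps_invoke {l : List (Action C B S V D)} (hl : MemSteps δ W (A.initMem S) l)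
    {c : C} (hc : ∀ a ∈ l, ∃ c', c ≠ c' ∧ IsActionOf c' a) {o : RegOp V}
    (ho : (∃ v, o = .write v) → c ∈ W) :
    MemSteps δ W (A.initMem S) (l ++ [.invoke c 0 o]) := by
  have h := localEq_memAfter (A.initMem S) hc
  refine memSteps_append_singleton.2 ⟨hl, ⟨?_, ?_, h.numInvoked, ho⟩, by simp⟩
  · exact h.crashed.not.1 (by simp [initMem, initConfig])
  · exact h.busy.not.1 (by simp [initMem, initConfig])

theorem numInvoked_solo {K : List (Action C B S V D)} {Bl : Finset S} {c : C}
    (hK : ∀ x ∈ K, IsSoloAction δ Bl c x) (X : A.MemConfig S) :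
    (memAfter X K).cfg.numInvoked = X.cfg.numInvoked := by
  induction K generalizing X with
  | nil => rfl
  | cons x K ih =>
    rw [memAfter_cons, ih fun a ha => hK a (by simp [ha])]
    have := hK x (by simp)
    cases x <;> first | exact this.elim | rfl

theorem highSchedule_solo {K : List (Action C B S V D)} {Bl : Finset S} {c : C}
    (hK : ∀ x ∈ K, IsSoloAction δ Bl c x) : highSchedule K = [] := by
  rw [highSchedule, List.filterMap_eq_nil_iff]
  intro x hx
  have := hK x hx
  cases x <;> first | exact this.elim | rfl

theorem highSchedule_flush (P : List (C × ℕ × B)) :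
    highSchedule (flush P : List (Action C B S V D)) = [] := by
  simp [highSchedule, flush, highEvent]

theorem highSchedule_append (l l' : List (Action C B S V D)) :
    highSchedule (l ++ l') = highSchedule l ++ highSchedule l' :=
  List.filterMap_append

/-- The part `K` may contain responses from any server, so the set of silent servers can be chosen
anew at any point of an operation. -/
theorem ObstructionFree.exists_solo_of_fresh [Countable C] {f : ℕ} (hA : A.ObstructionFree δ W f)
    {l : List (Action C B S V D)} {c : C} (hc : ∀ a ∈ l, ∃ c', c ≠ c' ∧ IsActionOf c' a)
    {o : RegOp V} {K : List (Action C B S V D)} (hK : ∀ x ∈ K, IsSoloAction δ ∅ c x)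
    (h : MemSteps δ W (A.initMem S) (l ++ .invoke c 0 o :: K)) {Bl : Finset S} (hBl : Bl.card ≤ f) :
    ∃ K' a, (∀ x ∈ K', IsSoloAction δ Bl c x) ∧
      MemSteps δ W (A.initMem S) (l ++ .invoke c 0 o :: (K ++ K') ++ [.ret c 0 a]) := by
  have hcl {x} (hx : x ∈ l) (h : IsActionOf c x) : False := by
    obtain ⟨c', hne, hc'⟩ := hc x hx
    cases x <;> first | exact hc'.elim | exact hne (h.symm.trans hc')
  have hmem {x} (hx : x ∈ l ++ .invoke c 0 o :: K) (hcx : IsActionOf c x) :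
      x = .invoke c 0 o ∨ IsSoloAction δ ∅ c x := by
    rcases List.mem_append.1 hx with hx | hx
    · exact (hcl hx hcx).elim
    · exact (List.mem_cons.1 hx).imp_right (hK x)
  have hact : ∀ x ∈ l ++ .invoke c 0 o :: K, ∃ c, IsActionOf c x := by
    intro x hx
    rcases List.mem_append.1 hx with hx | hx
    · obtain ⟨c', -, h⟩ := hc x hx
      exact ⟨c', h⟩
    · rcases List.mem_cons.1 hx with rfl | hx
      · exact ⟨c, rfl⟩
      · exact ⟨c, (hK x hx).isActionOf⟩
  have huniq : ∀ m' o', Action.invoke c m' o' ∈ l ++ .invoke c 0 o :: K → m' = 0 := by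
    intro m' o' hx
    rcases hmem hx rfl with h | h
    · simp only [Action.invoke.injEq] at h
      exact h.2.1
    · exact h.elim
  have hret : ∀ m' a, Action.ret c m' a ∉ l ++ .invoke c 0 o :: K := by
    intro m' a hx
    rcases hmem hx rfl with h | h
    · simp at h
    · exact h.elim
  have hnum : (memAfter (A.initMem S) (l ++ .invoke c 0 o :: K)).cfg.numInvoked c = 0 + 1 := by
    rw [memAfter_append, memAfter_cons, numInvoked_solo hK]
    have : (memAfter (A.initMem S) l).cfg.numInvoked c = 0 :=
      (localEq_memAfter (A.initMem S) hc).numInvoked.symm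
    simp [memApply, apply, this]
  obtain ⟨K', a, hK', hst⟩ := hA.exists_solo h hact (o := o) (by simp) huniq hret hnum Bl hBl
  exact ⟨K', a, hK', by simpa using hst⟩

/-! ### Sequences of complete writes that leave writes pending -/

/-- In the run `l`, the clients in `U` execute the sequence `M` of writes and leave the low-level
writes in `P`, which cover pairwise different base registers, pending. -/
structure IsCovering (A : Emulation.{uC, uB, uV, uD, uT} C B V D) (δ : B → S) (W : Finset C)
    (l : List (Action C B S V D)) (P : List (C × ℕ × B)) (U : Finset C)
    (M : List (SeqOp (C × ℕ) V)) : Prop where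
  steps : MemSteps δ W (A.initMem S) l
  actors : ∀ a ∈ l, ∃ c ∈ U, IsActionOf c a
  high : highSchedule l = seqSchedule M
  nodup_ids : (M.map SeqOp.id).Nodup
  ids : ∀ e ∈ M, e.id.1 ∈ U
  writes : ∀ e ∈ M, ∃ v, e.op = .write v
  pending : ∀ p ∈ P, p ∈ (memAfter (A.initMem S) l).cfg.pending
  ops : ∀ p ∈ P, ∃ v, (memAfter (A.initMem S) l).opOf (p.1, p.2.1) = .write v
  nodup : (P.map (·.2.2)).Nodup

theorem IsCovering.client_mem {l : List (Action C B S V D)} {P : List (C × ℕ × B)} {U : Finset C}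
    {M : List (SeqOp (C × ℕ) V)} (h : IsCovering A δ W l P U M) {p : C × ℕ × B} (hp : p ∈ P) :
    p.1 ∈ U := by
  have := h.steps.exists_trigger_of_pending (h.pending p hp)
  obtain ⟨c, hc, hc'⟩ := h.actors _ this
  have : p.1 = c := hc'
  exact this ▸ hc

theorem IsCovering.fresh {l : List (Action C B S V D)} {P : List (C × ℕ × B)} {U : Finset C}
    {M : List (SeqOp (C × ℕ) V)} (h : IsCovering A δ W l P U M) {c : C} (hc : c ∉ U) :
    ∀ a ∈ l, ∃ c', c ≠ c' ∧ IsActionOf c' a := fun a ha =>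
  let ⟨c', hc', h'⟩ := h.actors a ha
  ⟨c', by rintro rfl; exact hc hc', h'⟩

theorem IsCovering.localEq_of_mem {l : List (Action C B S V D)} {P : List (C × ℕ × B)}
    {U : Finset C} {M : List (SeqOp (C × ℕ) V)} (h : IsCovering A δ W l P U M) {c : C} (hc : c ∉ U)
    {K : List (Action C B S V D)} (hK : ∀ x ∈ K, IsActionOf c x) {p : C × ℕ × B} (hp : p ∈ P) :
    LocalEq p.1 (memAfter (A.initMem S) l) (memAfter (A.initMem S) (l ++ K)) := by
  rw [memAfter_append]
  exact localEq_memAfter _ fun x hx =>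
    ⟨c, fun he => hc (he ▸ h.client_mem hp), hK x hx⟩

/-- Extending a run of writes by another complete write. -/
theorem IsCovering.append [DecidableEq C] {l : List (Action C B S V D)} {P P' : List (C × ℕ × B)}
    {U : Finset C} {M : List (SeqOp (C × ℕ) V)} (h : IsCovering A δ W l P U M) {c : C} (hc : c ∉ U)
    {v : V} {K : List (Action C B S V D)} (hK : ∀ x ∈ K, IsSoloAction δ ∅ c x) {a : RegResp V}
    (hst : MemSteps δ W (A.initMem S) (l ++ .invoke c 0 (.write v) :: K ++ [.ret c 0 a]))
    (hP' : ∀ p ∈ P', p ∈ (memAfter (A.initMem S)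
        (l ++ .invoke c 0 (.write v) :: K ++ [.ret c 0 a])).cfg.pending ∧
      ∃ v', (memAfter (A.initMem S)
        (l ++ .invoke c 0 (.write v) :: K ++ [.ret c 0 a])).opOf (p.1, p.2.1) = .write v')
    (hnodup : ((P ++ P').map (·.2.2)).Nodup) :
    IsCovering A δ W (l ++ .invoke c 0 (.write v) :: K ++ [.ret c 0 a]) (P ++ P') (insert c U)
      (M ++ [⟨(c, 0), .write v, a⟩]) := by
  have hact : ∀ x ∈ Action.invoke c 0 (.write v) :: K ++ [.ret c 0 a], IsActionOf c x := by
    intro x hx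
    rw [List.mem_append, List.mem_cons, List.mem_singleton] at hx
    rcases hx with (rfl | hx) | rfl
    exacts [rfl, (hK x hx).isActionOf, rfl]
  have hloc {p} (hp : p ∈ P) := h.localEq_of_mem hc hact hp
  rw [← List.append_assoc] at hloc
  constructor
  · exact hst
  · intro x hx
    rw [List.append_assoc, List.mem_append] at hx
    rcases hx with hx | hx
    · obtain ⟨c', hc', h'⟩ := h.actors x hx
      exact ⟨c', Finset.mem_insert_of_mem hc', h'⟩
    · exact ⟨c, Finset.mem_insert_self _ _, hact x hx⟩
  · rw [highSchedule_append, highSchedule_append, h.high, ← List.singleton_append,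
      highSchedule_append, highSchedule_solo hK]
    simp [highSchedule, highEvent, seqSchedule]
  · rw [List.map_append, List.nodup_append]
    refine ⟨h.nodup_ids, by simp, ?_⟩
    rintro _ hi _ hi' rfl
    obtain ⟨e, he, heq⟩ := List.mem_map.1 hi
    rw [List.map_singleton, List.mem_singleton] at hi'
    exact hc (by simpa [heq, hi'] using h.ids e he)
  · intro e he
    rw [List.mem_append, List.mem_singleton] at he
    rcases he with he | rfl
    · exact Finset.mem_insert_of_mem (h.ids e he)
    · exact Finset.mem_insert_self _ _
  · intro e he
    rw [List.mem_append, List.mem_singleton] at he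
    rcases he with he | rfl
    · exact h.writes e he
    · exact ⟨v, rfl⟩
  · intro p hp
    rcases List.mem_append.1 hp with hp | hp
    · exact ((hloc hp).pending _ _).1 (h.pending p hp)
    · exact (hP' p hp).1
  · intro p hp
    rcases List.mem_append.1 hp with hp | hp
    · rw [← (hloc hp).opOf]
      exact h.ops p hp
    · exact (hP' p hp).2
  · exact hnodup

theorem IsCovering.memSteps_flush {l : List (Action C B S V D)} {P : List (C × ℕ × B)}
    {U : Finset C} {M : List (SeqOp (C × ℕ) V)} (h : IsCovering A δ W l P U M) :
    MemSteps δ W (A.initMem S) (l ++ flush P) := by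
  have hact : ∀ a ∈ l, ∃ c, IsActionOf c a := fun a ha =>
    let ⟨c, _, hc⟩ := h.actors a ha; ⟨c, hc⟩
  refine memSteps_append.2 ⟨h.steps, Emulation.memSteps_flush ?_ ?_ h.nodup.of_map
    fun p hp => ⟨h.pending p hp, h.ops p hp⟩⟩
  · rw [crashedClients_memAfter hact]; rfl
  · rw [crashedServers_memAfter hact]; rfl

theorem IsCovering.read_eq {l : List (Action C B S V D)} {P : List (C × ℕ × B)}
    {U : Finset C} {M : List (SeqOp (C × ℕ) V)} (h : IsCovering A δ W l P U M) {v₀ : V} {f : ℕ}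
    (hA : A.WSSafe δ W v₀ f) {r : C} (hr : r ∉ U) {K : List (Action C B S V D)}
    (hK : ∀ x ∈ K, IsSoloAction δ ∅ r x) {a : RegResp V}
    (hst : MemSteps δ W (A.initMem S) (l ++ flush P ++ (.invoke r 0 .read :: K ++ [.ret r 0 a]))) :
    a = .val (finalValue v₀ M) := by
  have hact : ∀ x ∈ l ++ flush P ++ (.invoke r 0 .read :: K ++ [.ret r 0 a]),
      ∃ c, IsActionOf c x := by
    intro x hx
    simp only [List.mem_append, List.mem_cons, List.not_mem_nil, or_false] at hx
    rcases hx with (hx | hx) | ((rfl | hx) | rfl)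
    · obtain ⟨c, -, hc⟩ := h.actors x hx
      exact ⟨c, hc⟩
    · obtain ⟨p, -, hp⟩ := exists_isActionOf_flush hx
      exact ⟨_, hp⟩
    · exact ⟨r, rfl⟩
    · exact ⟨r, (hK x hx).isActionOf⟩
    · exact ⟨r, rfl⟩
  -- No server crashes in this run, so safety applies whichever servers were silent during `K`.
  have hsafe := hA _ hst.isRun (by rw [crashedIn_eq_empty hact]; simp)
  have hhigh : highSchedule (l ++ flush P ++ (.invoke r 0 .read :: K ++ [.ret r 0 a])) =
      seqSchedule (M ++ [⟨(r, 0), .read, a⟩]) := by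
    rw [highSchedule_append, highSchedule_append, highSchedule_append, h.high,
      ← List.singleton_append, highSchedule_append, highSchedule_solo hK, highSchedule_flush]
    simp [highSchedule, highEvent, seqSchedule]
  rw [hhigh] at hsafe
  refine hsafe.read_eq ?_ h.writes
  rw [List.map_append, List.nodup_append]
  refine ⟨h.nodup_ids, by simp, ?_⟩
  rintro _ hi _ hi' rfl
  obtain ⟨e, he, heq⟩ := List.mem_map.1 hi
  rw [List.map_singleton, List.mem_singleton] at hi'
  exact hr (by simpa [heq, hi'] using h.ids e he)

/-- A write of a new value cannot complete when its effect, apart from covered registers, is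
confined to `f` servers. -/
theorem IsCovering.exists_mem_ne [Countable C] {l : List (Action C B S V D)}
    {P : List (C × ℕ × B)} {U : Finset C} {M : List (SeqOp (C × ℕ) V)}
    (h : IsCovering A δ W l P U M) {v₀ : V} {f : ℕ} (hA : A.IsTolerantEmulation δ W v₀ f)
    {r : C} (hr : r ∉ W) (hU : U ⊆ W) {c : C} (hcW : c ∈ W) (hc : c ∉ U) {v : V}
    (hv : v ≠ finalValue v₀ M) {K : List (Action C B S V D)}
    (hK : ∀ x ∈ K, IsSoloAction δ ∅ c x) {a : RegResp V}
    (hst : MemSteps δ W (A.initMem S) (l ++ .invoke c 0 (.write v) :: K ++ [.ret c 0 a]))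
    {R : Finset S} (hR : R.card ≤ f) :
    ∃ b, (∀ p ∈ P, p.2.2 ≠ b) ∧ δ b ∉ R ∧
      (memAfter (A.initMem S) (l ++ .invoke c 0 (.write v) :: K)).mem b ≠
        (memAfter (A.initMem S) l).mem b := by
  classical
  by_contra! hmem
  have h' := h.append hc hK hst (P' := []) (by simp) (by simpa using h.nodup)
  rw [List.append_nil] at h'
  have hrU : r ∉ U := fun hrU => hr (hU hrU)
  have hrU' : r ∉ insert c U := by
    rw [Finset.mem_insert, not_or]
    exact ⟨by rintro rfl; exact hr hcW, hrU⟩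
  have hfresh {l U M} (h : IsCovering A δ W l P U M) (hrU : r ∉ U) :
      ∀ a ∈ l ++ flush P, ∃ c', r ≠ c' ∧ IsActionOf c' a := by
    intro x hx
    rcases List.mem_append.1 hx with hx | hx
    · exact h.fresh hrU x hx
    · obtain ⟨p, hp, hp'⟩ := exists_isActionOf_flush hx
      exact ⟨p.1, by rintro rfl; exact hrU (h.client_mem hp), hp'⟩
  have hinv := memSteps_invoke h.memSteps_flush (hfresh h hrU) (o := .read) (by simp)
  -- A solo read in the run without the new write, after the covering writes have taken effect and
  -- with `R` silent. It returns the old value.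
  obtain ⟨K', a', hK', hst'⟩ := hA.2.exists_solo_of_fresh (hfresh h hrU) (K := []) (by simp)
    (by simpa using hinv) hR
  rw [List.nil_append, List.append_assoc] at hst'
  have hK'' : ∀ x ∈ K', IsSoloAction δ ∅ r x := by
    intro x hx
    have := hK' x hx
    cases x <;> simp_all [IsSoloAction]
  have h₁ := h.read_eq hA.1 hrU hK'' hst'
  set l' := l ++ .invoke c 0 (.write v) :: K ++ [.ret c 0 a] with hl'
  -- With the new write included, flushing `P` makes the covered registers equal, and the uncovered
  -- ones outside `R` agree by the assumption `hmem`.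
  have hagree : AgreeOff δ R r (memAfter (A.initMem S) (l ++ flush P))
      (memAfter (A.initMem S) (l' ++ flush P)) := by
    have hact {l U M} (h : IsCovering A δ W l P U M) :
        ∀ a ∈ l ++ flush P, ∃ c', IsActionOf c' a := by
      intro x hx
      rcases List.mem_append.1 hx with hx | hx
      · obtain ⟨c', -, hc'⟩ := h.actors x hx
        exact ⟨c', hc'⟩
      · obtain ⟨p, hp, hp'⟩ := exists_isActionOf_flush hx
        exact ⟨p.1, hp'⟩
    refine ⟨(localEq_memAfter _ (hfresh h hrU)).symm.trans
      (localEq_memAfter _ (hfresh h' hrU')), ?_, fun b hb => ?_⟩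
    · rw [crashedServers_memAfter (hact h), crashedServers_memAfter (hact h')]
    · rw [memAfter_append, memAfter_append]
      refine mem_flush h.ops (fun p hp => ?_) fun hbP => ?_
      · have := (h.localEq_of_mem hc (K := .invoke c 0 (.write v) :: K ++ [.ret c 0 a]) ?_ hp).opOf
          p.2.1
        · rw [this, hl', List.append_assoc]
        · intro x hx
          rw [List.mem_append, List.mem_cons, List.mem_singleton] at hx
          rcases hx with (rfl | hx) | rfl
          exacts [rfl, (hK x hx).isActionOf, rfl]
      · rw [← hmem b hbP hb, hl', memAfter_append _ _ [_]]
        rfl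
  -- The same read, with the same result `a'`, therefore also occurs after the write of `v`, where
  -- safety demands `v`.
  have hst'' : MemSteps δ W (A.initMem S)
      (l' ++ flush P ++ (.invoke r 0 .read :: K' ++ [.ret r 0 a'])) := by
    refine memSteps_append.2 ⟨h'.memSteps_flush, hagree.memSteps ?_ (memSteps_append.1 hst').2⟩
    intro x hx
    rw [List.mem_append, List.mem_cons, List.mem_singleton] at hx
    rcases hx with (rfl | hx) | rfl
    · exact ⟨rfl, by simp⟩
    · refine ⟨(hK' x hx).isActionOf, ?_⟩
      rintro i b r' rfl
      exact (hK' _ hx).2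
    · exact ⟨rfl, by simp⟩
  have h₂ := h'.read_eq hA.1 hrU' hK'' hst''
  rw [finalValue_append_singleton, h₁] at h₂
  simp only [RegResp.val.injEq] at h₂
  exact hv h₂.symm

end Emulation

end RegisterEmulation

namespace RegisterEmulation.Emulation

variable {C : Type uC} {B : Type uB} {S : Type uS} {V : Type uV} {D : Type uD}
  {A : Emulation.{uC, uB, uV, uD, uT} C B V D} {δ : B → S} {W : Finset C}

/-! ### A write that covers new registers -/

/-- A response from `b` is excluded by `Bl`, and a new trigger uses a fresh number, so neither the
pending entry nor the recorded operation is disturbed. -/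
theorem pending_memApply_of_solo {l : List (Action C B S V D)}
    (hl : MemSteps δ W (A.initMem S) l) {Bl : Finset S} {c : C} {x : Action C B S V D}
    (hx : IsSoloAction δ Bl c x) (hen : MemEnabled δ W (memAfter (A.initMem S) l) x) {i : ℕ} {b : B}
    (hb : δ b ∈ Bl) (hp : (c, i, b) ∈ (memAfter (A.initMem S) l).cfg.pending) :
    (c, i, b) ∈ (memApply (memAfter (A.initMem S) l) x).cfg.pending ∧
      (memApply (memAfter (A.initMem S) l) x).opOf (c, i) =
        (memAfter (A.initMem S) l).opOf (c, i) := by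
  classical
  cases x with
  | trigger c' i' b' o =>
    obtain rfl : c' = c := hx
    refine ⟨Or.inl hp, Function.update_of_ne ?_ _ _⟩
    have hi' := hen.1.2.1
    have hi := hl.invariant.lt_numTriggered _ _ _ _ (hl.invariant.inv_mem _ _ _ hp)
    simp only [ne_eq, Prod.mk.injEq, true_and]
    omega
  | respond c' i' b' r =>
    refine ⟨⟨hp, ?_⟩, rfl⟩
    simp only [Set.mem_singleton_iff, Prod.mk.injEq]
    rintro ⟨-, -, rfl⟩
    exact hx.2 hb
  | _ => exact hx.elim

theorem pending_memAfter_of_solo {l K : List (Action C B S V D)} {Bl : Finset S} {c : C}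
    (hK : ∀ x ∈ K, IsSoloAction δ Bl c x) (hl : MemSteps δ W (A.initMem S) (l ++ K)) {i : ℕ} {b : B}
    (hb : δ b ∈ Bl) (hp : (c, i, b) ∈ (memAfter (A.initMem S) l).cfg.pending) :
    (c, i, b) ∈ (memAfter (A.initMem S) (l ++ K)).cfg.pending ∧
      (memAfter (A.initMem S) (l ++ K)).opOf (c, i) = (memAfter (A.initMem S) l).opOf (c, i) := by
  induction K using List.reverseRecOn with
  | nil => simpa using hp
  | append_singleton K x ih =>
    rw [← List.append_assoc] at hl ⊢
    obtain ⟨hl, hx⟩ := memSteps_append_singleton.1 hl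
    obtain ⟨h₁, h₂⟩ := ih (fun x hx => hK x (by simp [hx])) hl
    rw [memAfter_append (A.initMem S) (l ++ K), ← h₂]
    exact pending_memApply_of_solo hl (hK x (by simp)) hx hb h₁

/-- After `l`, client `c` has executed the part `K` of a write of `v`; its low-level writes to
registers not covered by `P` are pending, except on the servers in `R`. -/
structure IsConfined (A : Emulation.{uC, uB, uV, uD, uT} C B V D) (δ : B → S) (W : Finset C)
    (l : List (Action C B S V D)) (P : List (C × ℕ × B)) (c : C) (v : V)
    (K : List (Action C B S V D)) (R : Finset S) : Prop where
  solo : ∀ x ∈ K, IsSoloAction δ ∅ c x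
  steps : MemSteps δ W (A.initMem S) (l ++ .invoke c 0 (.write v) :: K)
  mem : ∀ b, (∀ p ∈ P, p.2.2 ≠ b) → δ b ∉ R →
    (memAfter (A.initMem S) (l ++ .invoke c 0 (.write v) :: K)).mem b =
      (memAfter (A.initMem S) l).mem b
  pending : ∀ i b w, Action.trigger c i b (.write w) ∈ K → (∀ p ∈ P, p.2.2 ≠ b) → δ b ∉ R →
    (c, i, b) ∈ (memAfter (A.initMem S) (l ++ .invoke c 0 (.write v) :: K)).cfg.pending ∧
    (memAfter (A.initMem S) (l ++ .invoke c 0 (.write v) :: K)).opOf (c, i) = .write w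

variable {l : List (Action C B S V D)} {P : List (C × ℕ × B)} {c : C} {v : V}
  {K : List (Action C B S V D)} {R : Finset S}

theorem IsConfined.mono {R' : Finset S} (h : IsConfined A δ W l P c v K R) (hR : R ⊆ R') :
    IsConfined A δ W l P c v K R' :=
  ⟨h.solo, h.steps, fun b hb hb' => h.mem b hb fun hR' => hb' (hR hR'),
    fun i b w hK hb hb' => h.pending i b w hK hb fun hR' => hb' (hR hR')⟩

variable [Fintype S]

open Classical in
/-- The servers on which `K` triggers a low-level write to a register not covered by `P`. -/
noncomputable def newServers (δ : B → S) (P : List (C × ℕ × B)) (K : List (Action C B S V D)) :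
    Finset S :=
  Finset.univ.filter fun s => ∃ c i b v, Action.trigger c i b (.write v) ∈ K ∧
    (∀ p ∈ P, p.2.2 ≠ b) ∧ δ b = s

theorem mem_newServers {P : List (C × ℕ × B)} {K : List (Action C B S V D)} {s : S} :
    s ∈ newServers δ P K ↔ ∃ c i b v, Action.trigger c i b (.write v) ∈ K ∧
      (∀ p ∈ P, p.2.2 ≠ b) ∧ δ b = s := by
  simp [newServers]

theorem newServers_append_singleton [DecidableEq S] (P : List (C × ℕ × B))
    (K : List (Action C B S V D)) (x : Action C B S V D) :
    newServers δ P (K ++ [x]) = newServers δ P K ∨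
      ∃ s ∉ newServers δ P K, newServers δ P (K ++ [x]) = insert s (newServers δ P K) := by
  by_cases h : newServers δ P (K ++ [x]) = newServers δ P K
  · exact Or.inl h
  right
  have hsub : newServers δ P K ⊆ newServers δ P (K ++ [x]) := by
    intro s hs
    obtain ⟨c, i, b, v, hK, hb⟩ := mem_newServers.1 hs
    exact mem_newServers.2 ⟨c, i, b, v, by simp [hK], hb⟩
  obtain ⟨s, hs, hs'⟩ := Finset.exists_of_ssubset (hsub.ssubset_of_ne (Ne.symm h))
  refine ⟨s, hs', Finset.Subset.antisymm (fun t ht => ?_) (Finset.insert_subset hs hsub)⟩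
  obtain ⟨c, i, b, v, hK, hb⟩ := mem_newServers.1 hs
  obtain ⟨c', i', b', v', hK', hb'⟩ := mem_newServers.1 ht
  rw [List.mem_append, List.mem_singleton] at hK hK'
  rw [Finset.mem_insert]
  rcases hK' with hK' | hK'
  · exact Or.inr (mem_newServers.2 ⟨c', i', b', v', hK', hb'⟩)
  · rcases hK with hK | hK
    · exact absurd (mem_newServers.2 ⟨c, i, b, v, hK, hb⟩) hs'
    · rw [← hK'] at hK
      simp only [Action.trigger.injEq] at hK
      left
      rw [← hb.2, ← hb'.2, hK.2.2.1]

/-- A response that takes effect as a write on an uncovered register outside `R` would come from a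
server in `newServers δ P K \ R`, but these servers are silent. Such writes therefore neither change
the memory nor cease to be pending. -/
theorem IsConfined.append [DecidableEq S] (h : IsConfined A δ W l P c v K R)
    (hc : ∀ a ∈ l, ∃ c', c ≠ c' ∧ IsActionOf c' a)
    {x : Action C B S V D} (hx : IsSoloAction δ (newServers δ P K \ R) c x)
    (hen : MemEnabled δ W (memAfter (A.initMem S) (l ++ .invoke c 0 (.write v) :: K)) x) :
    IsConfined A δ W l P c v (K ++ [x]) R := by
  classical
  have heq : l ++ Action.invoke c 0 (.write v) :: (K ++ [x]) =
      l ++ .invoke c 0 (.write v) :: K ++ [x] := by simp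
  have hsteps : MemSteps δ W (A.initMem S) (l ++ .invoke c 0 (.write v) :: (K ++ [x])) := by
    rw [heq]
    exact memSteps_append_singleton.2 ⟨h.steps, hen⟩
  have hafter : memAfter (A.initMem S) (l ++ .invoke c 0 (.write v) :: (K ++ [x])) =
      memApply (memAfter (A.initMem S) (l ++ .invoke c 0 (.write v) :: K)) x := by
    rw [heq, memAfter_append]
    rfl
  refine ⟨?_, hsteps, ?_, ?_⟩
  · intro y hy
    rw [List.mem_append, List.mem_singleton] at hy
    rcases hy with hy | rfl
    exacts [h.solo y hy, hx.mono (Finset.empty_subset _)]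
  · intro b hb hbR
    rw [hafter, ← h.mem b hb hbR]
    cases x with
    | respond c' i b' r =>
      obtain ⟨rfl, hb'⟩ := hx
      by_cases hbb : b = b'
      · subst hbb
        simp only [memApply, Function.update_self]
        have ht := h.steps.exists_trigger_of_pending hen.1.2.2
        cases ho : (memAfter (A.initMem S) (l ++ .invoke c' 0 (.write v) :: K)).opOf (c', i) with
        | read => rfl
        | write w =>
          rw [ho, List.mem_append, List.mem_cons] at ht
          rcases ht with ht | ht | ht
          · obtain ⟨c'', hne, h''⟩ := hc _ ht
            exact absurd h'' hne
          · simp at ht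
          · refine absurd (Finset.mem_sdiff.2 ⟨?_, hbR⟩) hb'
            exact mem_newServers.2 ⟨_, _, _, _, ht, hb, rfl⟩
      · simp [memApply, Function.update_of_ne hbb]
    | _ => rfl
  · intro i b w hK hb hbR
    rw [hafter]
    rw [List.mem_append, List.mem_singleton] at hK
    rcases hK with hK | rfl
    · obtain ⟨h₁, h₂⟩ := h.pending i b w hK hb hbR
      rw [← h₂]
      refine pending_memApply_of_solo h.steps hx hen ?_ h₁
      exact Finset.mem_sdiff.2 ⟨mem_newServers.2 ⟨_, _, _, _, hK, hb, rfl⟩, hbR⟩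
    · exact ⟨Or.inr rfl, by simp [memApply]⟩

/-- The walk along `K'` stops at the first action that reaches a new server, because from then on
that server has to be silent as well. A single action reaches at most one. -/
theorem IsConfined.walk [DecidableEq S] (h : IsConfined A δ W l P c v K R)
    (hc : ∀ a ∈ l, ∃ c', c ≠ c' ∧ IsActionOf c' a) {K' : List (Action C B S V D)}
    (hK' : ∀ x ∈ K', IsSoloAction δ (newServers δ P K \ R) c x)
    (hst : MemSteps δ W (A.initMem S) (l ++ .invoke c 0 (.write v) :: (K ++ K'))) :
    IsConfined A δ W l P c v (K ++ K') R ∨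
      ∃ K'' s, IsConfined A δ W l P c v K'' R ∧ s ∉ newServers δ P K ∧
        newServers δ P K'' = insert s (newServers δ P K) := by
  induction K' generalizing K with
  | nil => exact Or.inl (by simpa using h)
  | cons x K' ih =>
    have heq : l ++ Action.invoke c 0 (.write v) :: (K ++ x :: K') =
      l ++ .invoke c 0 (.write v) :: K ++ x :: K' := by simp
    have hx := h.append hc (hK' x (by simp)) (by
      rw [heq] at hst
      exact (memSteps_append.1 hst).2.1)
    rcases newServers_append_singleton (δ := δ) P K x with hT | ⟨s, hs, hT⟩
    · have := ih hx (by rw [hT]; exact fun y hy => hK' y (by simp [hy])) (by simpa using hst)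
      rw [hT] at this
      simpa using this
    · exact Or.inr ⟨_, s, hx, hs, hT⟩

/-- A complete write by a fresh client leaves low-level writes pending on `f` servers outside
`F`, in registers that are not yet covered. -/
theorem IsCovering.exists_write [Countable C] [DecidableEq S] {U : Finset C}
    {M : List (SeqOp (C × ℕ) V)}
    (h : IsCovering A δ W l P U M) {v₀ : V} {f : ℕ} (hA : A.IsTolerantEmulation δ W v₀ f)
    (hr : ∃ r, r ∉ W) (hU : U ⊆ W) (hcW : c ∈ W) (hc : c ∉ U)
    (hv : v ≠ finalValue v₀ M) {F : Finset S} (hF : F.card = f + 1) :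
    ∃ K a, (∀ x ∈ K, IsSoloAction δ ∅ c x) ∧
      MemSteps δ W (A.initMem S) (l ++ .invoke c 0 (.write v) :: K ++ [.ret c 0 a]) ∧
      ∃ Q : Finset S, f ≤ Q.card ∧ Disjoint Q F ∧ ∀ s ∈ Q, ∃ i b w, δ b = s ∧
        (∀ p ∈ P, p.2.2 ≠ b) ∧
        (c, i, b) ∈ (memAfter (A.initMem S)
          (l ++ .invoke c 0 (.write v) :: K ++ [.ret c 0 a])).cfg.pending ∧
        (memAfter (A.initMem S)
          (l ++ .invoke c 0 (.write v) :: K ++ [.ret c 0 a])).opOf (c, i) = .write w := by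
  obtain ⟨r, hr⟩ := hr
  have hfresh := h.fresh hc
  -- `R` is the set of released servers and `newServers δ P K \ R` the set of blocked ones. The
  -- blocked set has size exactly `f` once anything has been released. The induction is on the
  -- number of servers not yet reached.
  have loop : ∀ n K R, IsConfined A δ W l P c v K R → R ⊆ F →
      (newServers δ P K \ R).card ≤ f → (R = ∅ ∨ (newServers δ P K \ R).card = f) →
      Fintype.card S - (newServers δ P K).card = n → ∃ K R, IsConfined A δ W l P c v K R ∧
        R ⊆ F ∧ (newServers δ P K \ R).card ≤ f ∧ f ≤ ((newServers δ P K \ R) \ F).card := by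
    intro n
    induction n using Nat.strong_induction_on with
    | _ n ih =>
    intro K R hK hRF hcard hRT hn
    by_cases hQ : f ≤ ((newServers δ P K \ R) \ F).card
    · exact ⟨K, R, hK, hRF, hcard, hQ⟩
    push Not at hQ
    obtain ⟨K', a, hK', hst⟩ := hA.2.exists_solo_of_fresh hfresh hK.solo hK.steps hcard
    rcases hK.walk hfresh hK' (memSteps_append.1 hst).1 with hdone | ⟨K'', s, hK'', hs, hT⟩
    · have hR : R.card ≤ f := by
        rcases hRT with rfl | hRT
        · simp
        · have : ¬ (newServers δ P K \ R) ⊆ (newServers δ P K \ R) \ F := fun hsub => by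
            have := Finset.card_le_card hsub
            omega
          obtain ⟨s, hs, hs'⟩ := Finset.not_subset.1 this
          have hsF : s ∈ F := by
            by_contra hsF
            exact hs' (Finset.mem_sdiff.2 ⟨hs, hsF⟩)
          have hlt := Finset.card_lt_card (Finset.ssubset_iff_subset_ne.2
            ⟨hRF, fun he => (Finset.mem_sdiff.1 hs).2 (he ▸ hsF)⟩)
          omega
      -- The write has returned with its effects confined to `R` and the covered registers, which is
      -- impossible.
      obtain ⟨b, hb, hbR, hne⟩ := h.exists_mem_ne hA hr hU hcW hc hv hdone.solo hst hR
      exact absurd (hdone.mem b hb hbR) hne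
    · have hcardT : (newServers δ P K'').card = (newServers δ P K).card + 1 := by
        rw [hT, Finset.card_insert_of_notMem hs]
      have hle := Finset.card_le_univ (newServers δ P K'')
      have hdec : Fintype.card S - (newServers δ P K'').card < n := by omega
      have hsub : newServers δ P K'' \ R ⊆ insert s (newServers δ P K \ R) := by
        rw [hT]
        intro t ht
        simp only [Finset.mem_sdiff, Finset.mem_insert] at ht ⊢
        tauto
      have hsub' : newServers δ P K \ R ⊆ newServers δ P K'' \ R := by
        rw [hT]
        exact Finset.sdiff_subset_sdiff (Finset.subset_insert _ _) subset_rfl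
      have hle₁ := (Finset.card_le_card hsub).trans (Finset.card_insert_le _ _)
      have hle₂ := Finset.card_le_card hsub'
      by_cases hf : (newServers δ P K'' \ R).card ≤ f
      · exact ih _ hdec K'' R hK'' hRF hf (hRT.imp_right fun h => by omega) rfl
      · have : ¬ (newServers δ P K'' \ R) ⊆ (newServers δ P K'' \ R) \ F := fun hsub₂ => by
          have h₁ := Finset.card_le_card hsub₂
          have h₂ : (newServers δ P K'' \ R) \ F ⊆ insert s ((newServers δ P K \ R) \ F) := by
            intro t ht
            have := hsub (Finset.mem_sdiff.1 ht).1
            simp only [Finset.mem_sdiff, Finset.mem_insert] at ht this ⊢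
            tauto
          have h₃ := (Finset.card_le_card h₂).trans (Finset.card_insert_le _ _)
          omega
        obtain ⟨t, ht, ht'⟩ := Finset.not_subset.1 this
        have htF : t ∈ F := by
          by_contra htF
          exact ht' (Finset.mem_sdiff.2 ⟨ht, htF⟩)
        have hcard' : (newServers δ P K'' \ insert t R).card = f := by
          rw [Finset.sdiff_insert, Finset.card_erase_of_mem ht]
          omega
        exact ih _ hdec K'' (insert t R) (hK''.mono (Finset.subset_insert _ _))
          (Finset.insert_subset htF hRF) hcard'.le (Or.inr hcard') rfl
  have hinv := memSteps_invoke h.steps hfresh (o := .write v) fun _ => hcW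
  have hempty : newServers δ P ([] : List (Action C B S V D)) = ∅ := by
    ext s
    simp [mem_newServers]
  have h₀ : IsConfined A δ W l P c v [] ∅ := by
    refine ⟨by simp, hinv, fun b _ _ => ?_, by simp⟩
    rw [memAfter_append]
    rfl
  obtain ⟨K, R, hK, hRF, hcard, hQ⟩ := loop _ [] ∅ h₀ (Finset.empty_subset _)
    (by simp [hempty]) (Or.inl rfl) rfl
  -- The write is completed with the blocked servers still silent, so the writes found on them stay
  -- pending.
  obtain ⟨K', a, hK', hst⟩ := hA.2.exists_solo_of_fresh hfresh hK.solo hK.steps hcard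
  refine ⟨K ++ K', a, ?_, hst, (newServers δ P K \ R) \ F, hQ, Finset.sdiff_disjoint,
    fun s hs => ?_⟩
  · intro x hx
    rcases List.mem_append.1 hx with hx | hx
    exacts [hK.solo x hx, (hK' x hx).mono (Finset.empty_subset _)]
  · have hs' := (Finset.mem_sdiff.1 hs).1
    obtain ⟨hsT, hsR⟩ := Finset.mem_sdiff.1 hs'
    obtain ⟨c', i, b, w, ht, hb, rfl⟩ := mem_newServers.1 hsT
    obtain rfl : c' = c := hK.solo _ ht
    obtain ⟨hp, ho⟩ := hK.pending i b w ht hb hsR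
    have heq : l ++ Action.invoke c' 0 (.write v) :: (K ++ K') =
      l ++ .invoke c' 0 (.write v) :: K ++ K' := by simp
    obtain ⟨hp', ho'⟩ := pending_memAfter_of_solo hK' (heq ▸ (memSteps_append.1 hst).1) hs' hp
    rw [ho] at ho'
    refine ⟨i, b, w, rfl, hb, ?_⟩
    rw [memAfter_append, heq]
    exact ⟨hp', ho'⟩

/-- Induction on the writers used so far: each fresh writer contributes one uncovered register on
each of at least `f` servers outside `F`, and the old coverings persist because their clients take
no further steps. -/
theorem exists_isCovering [Countable C] [Nontrivial V] {v₀ : V} {f : ℕ}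
    (hA : A.IsTolerantEmulation δ W v₀ f) (hr : ∃ r, r ∉ W) {F : Finset S} (hF : F.card = f + 1)
    {U : Finset C} (hU : U ⊆ W) : ∃ l P M, IsCovering A δ W l P U M ∧
      U.card * f ≤ P.length ∧ ∀ p ∈ P, δ p.2.2 ∉ F := by
  classical
  induction U using Finset.induction_on with
  | empty =>
    exact ⟨[], [], [], ⟨trivial, by simp, rfl, by simp, by simp, by simp, by simp, by simp,
      by simp⟩, by simp, by simp⟩
  | insert c U hc ih =>
    rw [Finset.insert_subset_iff] at hU
    obtain ⟨l, P, M, h, hlen, hPF⟩ := ih hU.2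
    -- The written value must differ from the current one, so that a later read can detect the
    -- write.
    obtain ⟨v, hv⟩ := exists_ne (finalValue v₀ M)
    obtain ⟨K, a, hK, hst, Q, hQ, hQF, hpend⟩ := h.exists_write hA hr hU.2 hU.1 hc hv hF
    choose i b w hδ hbP hp ho using hpend
    refine ⟨_, P ++ Q.attach.toList.map fun s : {s // s ∈ Q} => (c, i s s.2, b s s.2), _,
      h.append hc hK hst ?_ ?_, ?_, ?_⟩
    · simp only [List.mem_map]
      rintro _ ⟨s, -, rfl⟩
      exact ⟨hp s s.2, w s s.2, ho s s.2⟩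
    · rw [List.map_append, List.nodup_append, List.map_map]
      refine ⟨h.nodup, ?_, ?_⟩
      · refine Q.attach.nodup_toList.map fun (s t : {s // s ∈ Q}) hst => Subtype.ext ?_
        rw [← hδ s s.2, ← hδ t t.2]
        exact congrArg δ hst
      · rintro _ hx _ hy rfl
        obtain ⟨p, hpP, hpb⟩ := List.mem_map.1 hx
        obtain ⟨s, -, hsb⟩ := List.mem_map.1 hy
        exact hbP s s.2 p hpP (hpb.trans hsb.symm)
    · rw [Finset.card_insert_of_notMem hc, List.length_append, List.length_map,
        Finset.length_toList, Finset.card_attach, add_mul, one_mul]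
      omega
    · intro p hp'
      rcases List.mem_append.1 hp' with hp' | hp'
      · exact hPF p hp'
      · obtain ⟨s, -, rfl⟩ := List.mem_map.1 hp'
        rw [hδ s s.2]
        exact Finset.disjoint_left.1 hQF s.2

theorem exists_covered [Countable C] [Nontrivial V] {v₀ : V} {f : ℕ}
    (hA : A.IsTolerantEmulation δ W v₀ f) (hr : ∃ r, r ∉ W) {F : Finset S} (hF : F.card = f + 1) :
    ∃ T : Finset B, (T : Set B) ⊆ A.usedRegisters δ W ∧ W.card * f ≤ T.card ∧
      ∀ b ∈ T, δ b ∉ F := by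
  classical
  obtain ⟨l, P, M, h, hlen, hPF⟩ := exists_isCovering hA hr hF (subset_refl W)
  refine ⟨(P.map (·.2.2)).toFinset, ?_, ?_, ?_⟩
  · intro b hb
    rw [Finset.mem_coe, List.mem_toFinset] at hb
    obtain ⟨p, hp, rfl⟩ := List.mem_map.1 hb
    exact ⟨l, h.steps.isRun, _, _, _, h.steps.exists_trigger_of_pending (h.pending p hp)⟩
  · rw [List.toFinset_card_of_nodup h.nodup, List.length_map]
    exact hlen
  · intro b hb
    rw [List.mem_toFinset] at hb
    obtain ⟨p, hp, rfl⟩ := List.mem_map.1 hb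
    exact hPF p hp

/-! ### Counting -/

/-- The hypothesis is used for two sets `F`: one containing all servers that hold at least `q`
registers, to show that there are more than `f` of these, and one consisting only of such servers.
-/
theorem registerBound_le_card [DecidableEq S] {k f : ℕ} (hf : 0 < f)
    (hS : 2 * f + 1 ≤ Fintype.card S) (N : Finset B)
    (h : ∀ F : Finset S, F.card = f + 1 → ∃ T ⊆ N, k * f ≤ T.card ∧ ∀ b ∈ T, δ b ∉ F) :
    registerBound k f (Fintype.card S) ≤ N.card := by
  classical
  set q := ⌈((k : ℚ) * f) / ((Fintype.card S : ℚ) - (f + 1))⌉₊ with hq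
  set big := Finset.univ.filter fun s : S => q ≤ (N.filter (δ · = s)).card with hbig
  have hbig_card : f + 1 ≤ big.card := by
    by_contra! hlt
    obtain ⟨F, hbF, -, hF⟩ := Finset.exists_subsuperset_card_eq (Finset.subset_univ big)
      (n := f + 1) hlt.le (by rw [Finset.card_univ]; omega)
    obtain ⟨T, hTN, hT, hTF⟩ := h F hF
    have hpos : (0 : ℚ) < (Fintype.card S : ℚ) - (f + 1) := by
      have : (2 * f + 1 : ℚ) ≤ Fintype.card S := by exact_mod_cast hS
      have : (0 : ℚ) < f := by exact_mod_cast hf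
      linarith
    have hFc : Fᶜ.card = Fintype.card S - (f + 1) := by rw [Finset.card_compl, hF]
    have hsmall : ∀ s ∈ Fᶜ, (T.filter (δ · = s)).card ≤ q - 1 := by
      intro s hs
      have : s ∉ big := fun hsb => Finset.mem_compl.1 hs (hbF hsb)
      rw [hbig, Finset.mem_filter_univ, not_le] at this
      have := Finset.card_le_card (Finset.filter_subset_filter (δ · = s) hTN)
      omega
    have hTle : T.card ≤ Fᶜ.card * (q - 1) := by
      refine Finset.card_le_mul_card_image_of_maps_to (f := δ) ?_ _ hsmall |>.trans_eq (mul_comm _ _)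
      exact fun b hb => Finset.mem_compl.2 (hTF b hb)
    have hkq : k * f ≤ Fᶜ.card * (q - 1) := hT.trans hTle
    -- For `q = 0` every server would count as big. So the truncated `q - 1` is a genuine
    -- predecessor.
    have hkpos : q ≠ 0 := by
      intro hq0
      have : big = Finset.univ := by
        rw [hbig, hq0]
        simp
      rw [this, Finset.card_univ] at hlt
      omega
    -- Dividing `k * f ≤ Fᶜ.card * (q - 1)` by the size of `Fᶜ` bounds the quotient, and hence its
    -- ceiling `q`, by `q - 1`.
    have hqle : q ≤ q - 1 := by
      rw [hq, Nat.ceil_le, div_le_iff₀ hpos, ← hq]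
      have : ((k * f : ℕ) : ℚ) ≤ ((Fᶜ.card * (q - 1) : ℕ) : ℚ) := by exact_mod_cast hkq
      rw [hFc] at this
      push_cast [Nat.cast_sub (show f + 1 ≤ Fintype.card S by omega)] at this
      linarith
    omega
  obtain ⟨F, hFb, hF⟩ := Finset.exists_subset_card_eq hbig_card
  obtain ⟨T, hTN, hT, hTF⟩ := h F hF
  have hin : F.card * q ≤ (N.filter (δ · ∈ F)).card := by
    rw [mul_comm]
    refine Finset.mul_card_image_le_card_of_maps_to (f := δ) (fun b hb => (Finset.mem_filter.1 hb).2) q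
      fun s hs => ?_
    refine (Finset.mem_filter_univ s |>.1 (hFb hs)).trans (Finset.card_le_card fun b hb => ?_)
    obtain ⟨hbN, rfl⟩ := Finset.mem_filter.1 hb
    exact Finset.mem_filter.2 ⟨Finset.mem_filter.2 ⟨hbN, hs⟩, rfl⟩
  have hout : k * f ≤ (N.filter (δ · ∉ F)).card :=
    hT.trans (Finset.card_le_card fun b hb => Finset.mem_filter.2 ⟨hTN hb, hTF b hb⟩)
  have := Finset.card_filter_add_card_filter_not (s := N) (δ · ∈ F)
  rw [registerBound, ← hq]
  rw [hF, mul_comm] at hin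
  omega

end RegisterEmulation.Emulation

/-! ### The lower bound -/

theorem mainTheorem1 {C : Type uC} {B : Type uB} {S : Type uS} {V : Type uV} {D : Type uD}
    [Countable C] [Fintype S] [Nontrivial V]
    (k f : ℕ) (hk : 0 < k) (hf : 0 < f)
    (W : Finset C) (hW : W.card = k) (hreader : ∃ c, c ∉ W)
    (δ : B → S) (hS : 2 * f + 1 ≤ Fintype.card S)
    (v₀ : V) (A : RegisterEmulation.Emulation.{uC, uB, uV, uD, uT} C B V D)
    (hA : A.IsTolerantEmulation δ W v₀ f) :
    (RegisterEmulation.registerBound k f (Fintype.card S) : ℕ∞) ≤ (A.usedRegisters δ W).encard ∧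
    (RegisterEmulation.registerBound k f (Fintype.card S) : ℕ∞) ≤ (δ ⁻¹' Set.univ).encard := by
  classical
  have h : (RegisterEmulation.registerBound k f (Fintype.card S) : ℕ∞) ≤
      (A.usedRegisters δ W).encard := by
    -- Base registers may be infinite in number; counting is needed only if finitely many are used.
    rcases (A.usedRegisters δ W).finite_or_infinite with hfin | hinf
    · rw [hfin.encard_eq_coe_toFinset_card]
      exact_mod_cast RegisterEmulation.Emulation.registerBound_le_card hf hS hfin.toFinset
        fun F hF => by
          obtain ⟨T, hT, hcard, hTF⟩ :=
            RegisterEmulation.Emulation.exists_covered hA hreader hF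
          exact ⟨T, fun b hb => hfin.mem_toFinset.2 (hT hb), hW ▸ hcard, hTF⟩
    · rw [hinf.encard_eq]
      exact le_top
  exact ⟨h, h.trans (Set.encard_le_encard (by simp))⟩
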